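/- Let $X$ be a compact metric space, $\underline X = X\times X$, and let $\underline{\mathcal H}$ be a hyper-RKHS over $X$: a reproducing kernel Hilbert space of functions $k:\underline X\to\mathbb R$ whose reproducing kernel $\underline k:\underline X\times\underline X\to\mathbb R$ is continuous, satisfies $\underline k((x,y),(u,v))=\underline k((y,x),(u,v))$, and is such that for each fixed $\underline x\in\underline X$ the function $(x,x')\mapsto\underline k(\underline x,(x,x'))$ is a positive semidefinite kernel on $X$. Let $\rho$ be a probability measure on $X\times X\times\mathbb R$ of the form $\rho(x,x',y)=\rho_X(x)\rho_X(x')\rho(y\mid x,x')$. For measurable $k$ put $\mathcal E(k)=\int (y-k(x,x'))^2\,d\rho$, and let $k^*(x,x')=\int y\,d\rho(y\mid x,x')$ be the regression function. Given a sample $\mathbf z=((x_i)_{i\le m},(y_{ij})_{i,j\le m})$, where $x_1,\dots,x_m$ are drawn independently from $\rho_X$ and then the $y_{ij}$ are drawn independently from $\rho(\cdot\mid x_i,x_j)$, let $$k_{\mathbf z,\lambda}=\operatorname*{arg\,min}_{k\in\underline{\mathcal H}}\Big\{\frac1{m^2}\sum_{i,j=1}^m\big(y_{ij}-k(x_i,x_j)\big)^2+\lambda\|k\|_{\underline{\mathcal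 H}}^2\Big\}.$$ For $B>0$ let $\pi_B(k)(x,x')=\max\{-B,\min\{B,k(x,x')\}\}$. Assume: (1) $|k^*(x,x')|\le M^*$ for $\rho_X\times\rho_X$-almost all $(x,x')$, with some $M^*\ge 1$; (2) for some $0<r\le1$ and $C_0$, $D(\lambda):=\inf_{k\in\underline{\mathcal H}}\{\mathcal E(k)-\mathcal E(k^*)+\lambda\|k\|_{\underline{\mathcal H}}^2\}\le C_0\lambda^r$ for all $\lambda>0$; (3) for some $M\ge1$ and $c>0$, $\int|y|^\ell\,d\rho(y\mid x,x')\le c\,\ell!\,M^\ell$ for all integers $\ell\ge1$ and all $(x,x')\in\underline X$; (4) for some $s>0$ and $C_s>0$, the covering numbers in $C(\underline X)$ with the sup norm of the unit ball $\mathcal B_1$ of $\underline{\mathcal H}$ satisfy $\log\mathcal N(\mathcal B_1,\eta)\le C_s\eta^{-s}$ for all $\eta>0$. Let $\lambda=m^{-\alpha}$ with $0<\alpha\le1$ and $\alpha<\frac{1+s}{s(2+s)}$, and put $$\Theta=\min\Big\{\alpha r,\ \frac1{2+s}-\frac{\alpha s}{1+s}\Big\}.$$ Then the minimizer $k_{\mathbf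 z,\lambda}$ exists and is unique for every sample, and for every $0<\epsilon<\Theta$ there is a constant $\widetilde C$, independent of $m$ and $\delta$, such that for all $m\ge1$ and all $0<\delta<1$, with confidence $1-\delta$, $$\big\|\pi_{M^*}(k_{\mathbf z,\lambda})-k^*\big\|_{L^2_{\rho_X}}^2\ \le\ \widetilde C\,\log\frac4\delta\; m^{\epsilon-\Theta},$$ where $\|k\|_{L^2_{\rho_X}}^2=\int_X\int_X|k(x,x')|^2\,d\rho_X(x)\,d\rho_X(x')$. -/

import Mathlib

open MeasureTheory ProbabilityTheory
open scoped NNReal ENNReal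

noncomputable section

namespace HyperRKHS

universe u v

/-- The hyper-kernel of a Hilbert space `H` of functions on `X × X`: the reproducing kernel of `H`,
so that `⟪k, hyperKernel H p ·⟫ = k p` for all `k : H` and `p : X × X`. -/
def hyperKernel {X : Type u} (H : Type v) [NormedAddCommGroup H] [InnerProductSpace ℝ H]
    [CompleteSpace H] [RKHS ℝ H (X × X) ℝ] (p q : X × X) : ℝ :=
  RKHS.kernel H p q 1

/-- `H` is a hyper-RKHS over `X`: a reproducing kernel Hilbert space of functions on `X × X`
whose kernel is symmetric in the two entries of its first pair, and is, for every fixed first pair,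
a positive semidefinite kernel on `X` in its second pair. (The reproducing property and the density
of the span of the kernel functions hold in every reproducing kernel Hilbert space.) -/
structure IsHyperRKHS (X : Type u) (H : Type v) [NormedAddCommGroup H] [InnerProductSpace ℝ H]
    [CompleteSpace H] [RKHS ℝ H (X × X) ℝ] : Prop where
  swap_fst : ∀ x y r s : X, hyperKernel H (x, y) (r, s) = hyperKernel H (y, x) (r, s)
  posSemidef_snd : ∀ p : X × X,
    (Matrix.of fun x x' : X => hyperKernel H p (x, x')).PosSemidef

/-- The ball of radius `R` of `H`, as a set of continuous functions with the sup norm. -/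
def ball {X : Type u} [TopologicalSpace X] (H : Type v) [NormedAddCommGroup H]
    [InnerProductSpace ℝ H] [RKHS ℝ H (X × X) ℝ] (R : ℝ) : Set C(X × X, ℝ) :=
  {f | ∃ k : H, ‖k‖ ≤ R ∧ ∀ p, f p = k p}

/-- The capacity condition `log 𝓝(𝓑₁, η) ≤ Cs (1/η)^s` for all `η > 0`, the (finite) covering
numbers being taken with respect to the sup norm on `C(X × X)`. -/
def CapacityCondition {X : Type u} [TopologicalSpace X] [CompactSpace X] (H : Type v)
    [NormedAddCommGroup H] [InnerProductSpace ℝ H] [RKHS ℝ H (X × X) ℝ] (s Cs : ℝ) : Prop :=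
  ∀ η : ℝ≥0, 0 < η →
    Metric.externalCoveringNumber η (ball (X := X) H 1) ≠ ⊤ ∧
      Real.log ((Metric.externalCoveringNumber η (ball (X := X) H 1)).toNat : ℝ)
        ≤ Cs * (1 / (η : ℝ)) ^ s

/-- The projection of a real number to `[-B, B]`. -/
def proj (B t : ℝ) : ℝ := if B < t then B else if t < -B then -B else t

section Distribution

variable {X : Type u} [MeasurableSpace X]

/-- The distribution `ρ(x, x', y) = ρX(x) ρX(x') ρ(y | x, x')` on `X × X × ℝ`. -/
def jointLaw (ρX : Measure X) (κ : Kernel (X × X) ℝ) : Measure ((X × X) × ℝ) :=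
  (ρX.prod ρX).compProd κ

/-- The target of least squares regression: the conditional mean of `y` given the pair. -/
def target (κ : Kernel (X × X) ℝ) (p : X × X) : ℝ := ∫ y, y ∂(κ p)

/-- The expected risk of `k` for the squared loss. -/
def risk (ρX : Measure X) (κ : Kernel (X × X) ℝ) (k : X × X → ℝ) : ℝ :=
  ∫ z, (z.2 - k z.1) ^ 2 ∂(jointLaw ρX κ)

/-- The regularization error `D(lam) = inf_k { E(k) - E(k*) + lam ‖k‖² }`. -/
def regError (H : Type v) [NormedAddCommGroup H] [InnerProductSpace ℝ H] [RKHS ℝ H (X × X) ℝ]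
    (ρX : Measure X) (κ : Kernel (X × X) ℝ) (lam : ℝ) : ℝ :=
  ⨅ k : H, (risk ρX κ k - risk ρX κ (target κ) + lam * ‖k‖ ^ 2)

/-- The moment hypothesis `∫ |y|^ℓ dρ(y | x, x') ≤ c ℓ! M^ℓ`, for all `ℓ ≥ 1` and all pairs. -/
def MomentHypothesis (κ : Kernel (X × X) ℝ) (c M : ℝ) : Prop :=
  ∀ ℓ : ℕ, 1 ≤ ℓ → ∀ p : X × X,
    ∫⁻ y, ENNReal.ofReal (|y| ^ ℓ) ∂(κ p) ≤ ENNReal.ofReal (c * (ℓ.factorial : ℝ) * M ^ ℓ)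

/-- Given the inputs `x₁, …, x_m`, the `m²` outputs `y_ij` are drawn independently from
`ρ(· | x_i, x_j)`. -/
def outputKernel (κ : Kernel (X × X) ℝ) [IsMarkovKernel κ] (m : ℕ) :
    Kernel (Fin m → X) (Fin m × Fin m → ℝ) where
  toFun x := Measure.pi fun ij : Fin m × Fin m => κ (x ij.1, x ij.2)
  measurable' := by
    refine Measurable.measure_of_isPiSystem_of_isProbabilityMeasure
      generateFrom_pi.symm isPiSystem_pi ?_
    rintro _ ⟨t, ht, rfl⟩
    simp only [Measure.pi_pi]
    refine Finset.measurable_prod _ fun ij _ => ?_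
    refine (κ.measurable_coe (ht ij (Set.mem_univ _))).comp ?_
    exact (measurable_pi_apply _).prodMk (measurable_pi_apply _)

instance (κ : Kernel (X × X) ℝ) [IsMarkovKernel κ] (m : ℕ) :
    IsMarkovKernel (outputKernel κ m) where
  isProbabilityMeasure x := by
    change IsProbabilityMeasure (Measure.pi fun ij : Fin m × Fin m => κ (x ij.1, x ij.2))
    infer_instance

/-- The law of the pairwise sample `((x_i)_i, (y_ij)_ij)`: the `x_i` are independent with law `ρX`,
and `y_ij` is drawn from `ρ(· | x_i, x_j)`. -/
def sampleLaw (ρX : Measure X) [IsProbabilityMeasure ρX] (κ : Kernel (X × X) ℝ) [IsMarkovKernel κ]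
    (m : ℕ) : Measure ((Fin m → X) × (Fin m × Fin m → ℝ)) :=
  (Measure.pi fun _ : Fin m => ρX).compProd (outputKernel κ m)

end Distribution

section Algorithm

variable {X : Type u} {H : Type v} [NormedAddCommGroup H] [InnerProductSpace ℝ H]
  [RKHS ℝ H (X × X) ℝ]

/-- The regularized empirical risk `(1/m²) ∑ (y_ij - k(x_i, x_j))² + lam ‖k‖²`. -/
def regEmpiricalRisk {m : ℕ} (lam : ℝ) (z : (Fin m → X) × (Fin m × Fin m → ℝ)) (k : H) : ℝ :=
  1 / (m : ℝ) ^ 2 * ∑ i : Fin m, ∑ j : Fin m, (z.2 (i, j) - k (z.1 i, z.1 j)) ^ 2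
    + lam * ‖k‖ ^ 2

/-- `k` is a solution `k_{z,lam}` of regularized least squares regression in `H`. -/
def IsRegLSSolution {m : ℕ} (lam : ℝ) (z : (Fin m → X) × (Fin m × Fin m → ℝ)) (k : H) : Prop :=
  ∀ k' : H, regEmpiricalRisk lam z k ≤ regEmpiricalRisk lam z k'

end Algorithm

/-- The power index `Θ = min {α r, 1/(2+s) - α s/(1+s)}`. -/
def powerIndex (α r s : ℝ) : ℝ := min (α * r) (1 / (2 + s) - α * s / (1 + s))

end HyperRKHS

end

open HyperRKHS

/-! Write y_ij = k*(x_i, x_j) + ξ_ij. Given the inputs, the m² variables ξ_ij are independent and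
centered, and the moment hypothesis gives them exponential moments. Comparing the minimizer k with a
near minimizer l of D(λ) bounds the empirical mean of (k* - k)² plus λ‖k‖²/2 by the empirical mean
of (k* - l)², plus 2λ‖l‖² and 3A²/λ, where A bounds the averaged pairing of the noise with elements
of norm one (`IsRegLSSolution.basic_inequality`).

Three estimates remain. A covering argument at radius η gives A of order √(η^(-s) + 1 + L)/m + η,
the factor 1/m reflecting m² independent noise variables
(`MomentHypothesis.exists_measure_sum_noise_le`). The empirical error of the fixed function l is
close to its mean (`measure_pairAverage_ge_le`). Finally λ‖k‖² is bounded, so k lies in a ball of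
radius of order m^(α/2), on which the integral of the clipped loss is controlled by its empirical
value uniformly (`measure_integral_projLoss_le`).

Pairs of inputs are dependent. Following Hoeffding, the off-diagonal average is a mean over
permutations of averages over ⌊m/2⌋ disjoint, hence independent, pairs, and Jensen's inequality
transfers exponential moments (`lintegral_exp_pairAverage_le`). The losses are nonnegative and
bounded, so a Chernoff bound that tolerates a factor 2 has error of order L/m instead of √(L/m).
With suitable covering radii every error is at most a constant times L m^(-Θ)
(`MomentHypothesis.exists_rate`). Existence and uniqueness of the minimizer come from Lax–Milgram.
-/

namespace HyperRKHS

universe u v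

/-! ### Evaluation bounds, nets of the unit ball, and the minimizer -/

section Space

variable {X : Type u} {H : Type v} [NormedAddCommGroup H] [InnerProductSpace ℝ H]
  [RKHS ℝ H (X × X) ℝ]

theorem inner_kerFun_one [CompleteSpace H] (k : H) (p : X × X) :
    inner ℝ (RKHS.kerFun H p (1 : ℝ)) k = k p := by
  rw [RKHS.kerFun_inner]; simp

/-- Elements of a reproducing kernel Hilbert space with continuous kernel are continuous. -/
theorem continuous_apply_of_continuous_kernel [CompleteSpace H] [TopologicalSpace X]
    (hcont : Continuous fun pq : (X × X) × (X × X) => hyperKernel H pq.1 pq.2) (k : H) :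
    Continuous fun p => k p := by
  -- The feature map is norm continuous: the squared distance of two features is a combination of
  -- kernel values that vanishes when the points coincide.
  have hker : Continuous fun p : X × X => (RKHS.kerFun H p (1 : ℝ) : H) := by
    rw [continuous_iff_continuousAt]
    intro p
    rw [ContinuousAt, tendsto_iff_norm_sub_tendsto_zero]
    have hi (a b : X × X) :
        inner ℝ (RKHS.kerFun H a (1 : ℝ)) (RKHS.kerFun H b (1 : ℝ) : H) = hyperKernel H b a := by
      rw [← RKHS.kernel_inner]; simp [hyperKernel]
    have hsq (q : X × X) : ‖(RKHS.kerFun H q (1 : ℝ) : H) - RKHS.kerFun H p (1 : ℝ)‖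
        = √(hyperKernel H q q - 2 * hyperKernel H p q + hyperKernel H p p) := by
      rw [← hi, ← hi, ← hi, ← Real.sqrt_sq (norm_nonneg _), norm_sub_sq_real,
        real_inner_self_eq_norm_sq, real_inner_self_eq_norm_sq]
    simp_rw [hsq]
    have : Continuous fun q : X × X =>
        √(hyperKernel H q q - 2 * hyperKernel H p q + hyperKernel H p p) := by
      have h1 := hcont.comp (f := fun q : X × X => (q, q)) (by fun_prop)
      have h2 := hcont.comp (f := fun q : X × X => (p, q)) (by fun_prop)
      exact Real.continuous_sqrt.comp ((h1.sub (h2.const_mul 2)).add continuous_const)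
    have h0 := this.tendsto p
    rwa [show hyperKernel H p p - 2 * hyperKernel H p p + hyperKernel H p p = 0 by ring,
      Real.sqrt_zero] at h0
  simp_rw [← inner_kerFun_one]
  exact hker.inner continuous_const

/-- Point evaluations are uniformly bounded over a compact input space. -/
theorem exists_abs_apply_le [CompleteSpace H] [TopologicalSpace X] [CompactSpace X]
    (hcont : Continuous fun pq : (X × X) × (X × X) => hyperKernel H pq.1 pq.2) :
    ∃ K : ℝ, 1 ≤ K ∧ ∀ (k : H) (p : X × X), |k p| ≤ K * ‖k‖ := by
  have h1 := hcont.comp (f := fun q : X × X => (q, q)) (by fun_prop)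
  obtain ⟨B, hB⟩ := (isCompact_range h1).bddAbove
  refine ⟨max 1 √B, le_max_left _ _, fun k p => ?_⟩
  have h2 : ‖RKHS.kernel H p p‖ ≤ B := by
    rw [RKHS.norm_kernel_eq_norm_kerFun_sq]
    have h3 : ‖RKHS.kerFun H p‖ ≤ ‖(RKHS.kerFun H p (1 : ℝ) : H)‖ := by
      refine ContinuousLinearMap.opNorm_le_bound _ (norm_nonneg _) fun x => ?_
      rw [← mul_one x, ← smul_eq_mul, map_smul, norm_smul, norm_smul, norm_one, mul_one, mul_comm]
    grw [h3]
    rw [← real_inner_self_eq_norm_sq, ← RKHS.kernel_inner]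
    refine le_trans (le_of_eq ?_) (hB ⟨p, rfl⟩)
    simp [hyperKernel]
  have h4 := RKHS.norm_apply_le k p
  rw [Real.norm_eq_abs, mul_comm] at h4
  exact h4.trans (mul_le_mul_of_nonneg_right
    ((Real.sqrt_le_sqrt h2).trans (le_max_right _ _)) (norm_nonneg _))

/-- A finite `η`-net of the unit ball whose cardinality obeys the capacity condition. -/
theorem CapacityCondition.exists_net [TopologicalSpace X] [CompactSpace X]
    {s Cs : ℝ} (hcap : CapacityCondition (X := X) H s Cs)
    (hcont : ∀ k : H, Continuous fun p => k p) {η : ℝ} (hη : 0 < η) :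
    ∃ N : Finset C(X × X, ℝ), 0 < N.card ∧ Real.log N.card ≤ Cs * (1 / η) ^ s ∧
      ∀ k : H, ‖k‖ ≤ 1 → ∃ f ∈ N, ∀ p, |k p - f p| ≤ η := by
  lift η to ℝ≥0 using hη.le
  obtain ⟨h1, h2⟩ := hcap η (by exact_mod_cast hη)
  set A := ball (X := X) H 1
  -- An infimum of extended naturals is attained, so some cover has exactly the covering number as
  -- cardinality. Its centers are arbitrary continuous functions, not necessarily elements of `H`.
  have : ∃ C : Set C(X × X, ℝ), Metric.IsCover η A C ∧
      C.encard = Metric.externalCoveringNumber η A := by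
    have hne : Nonempty {C : Set C(X × X, ℝ) // Metric.IsCover η A C} := ⟨A, by simp⟩
    obtain ⟨C, hC⟩ := ENat.exists_eq_iInf
      (fun C : {C : Set C(X × X, ℝ) // Metric.IsCover η A C} => C.1.encard)
    refine ⟨C.1, C.2, hC.trans ?_⟩
    rw [Metric.externalCoveringNumber, iInf_subtype]
  obtain ⟨C, hC, hcard⟩ := this
  have hfin : C.Finite := by
    rw [← Set.encard_ne_top_iff, hcard]; exact h1
  have hcov : ∀ k : H, ‖k‖ ≤ 1 → ∃ f ∈ C, ∀ p, |k p - f p| ≤ η := by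
    intro k hk
    obtain ⟨f, hf, hd⟩ := hC (show (⟨k, hcont k⟩ : C(X × X, ℝ)) ∈ A from ⟨k, hk, fun p => rfl⟩)
    refine ⟨f, hf, fun p => ?_⟩
    have h3 : dist (⟨k, hcont k⟩ : C(X × X, ℝ)) f ≤ η := by
      rw [dist_nndist]
      have : edist (⟨k, hcont k⟩ : C(X × X, ℝ)) f ≤ (η : ℝ≥0∞) := hd
      rw [edist_nndist] at this
      exact_mod_cast this
    exact (ContinuousMap.dist_apply_le_dist (f := ⟨k, hcont k⟩) (g := f) p).trans h3
  refine ⟨hfin.toFinset, ?_, ?_, ?_⟩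
  · obtain ⟨f, hf, -⟩ := hcov 0 (by simp)
    exact Finset.card_pos.2 ⟨f, by simpa using hf⟩
  · rw [← hcard, hfin.encard_eq_coe_toFinset_card] at h2
    simpa using h2
  · intro k hk
    obtain ⟨f, hf, h⟩ := hcov k hk
    exact ⟨f, by simpa using hf, h⟩

section LeastSquares

variable {E : Type v} [NormedAddCommGroup E] [InnerProductSpace ℝ E] [CompleteSpace E]

/-- Regularized least squares with finitely many linear observations has a unique minimizer. -/
theorem existsUnique_regularized_leastSquares {ι : Type*} [Fintype ι] (v : ι → E) (y : ι → ℝ)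
    {w lam : ℝ} (hw : 0 ≤ w) (hlam : 0 < lam) :
    ∃! k : E, ∀ k' : E, w * ∑ i, (y i - inner ℝ (v i) k) ^ 2 + lam * ‖k‖ ^ 2
      ≤ w * ∑ i, (y i - inner ℝ (v i) k') ^ 2 + lam * ‖k'‖ ^ 2 := by
  let I : E →L[ℝ] E →L[ℝ] ℝ := innerSL ℝ
  -- Half the Hessian of the objective. The regularizer makes it coercive, so Lax–Milgram solves the
  -- normal equations in any Hilbert space.
  let B : E →L[ℝ] E →L[ℝ] ℝ :=
    w • ∑ i, (innerSL ℝ (v i)).smulRight (innerSL ℝ (v i)) + lam • I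
  have hB (k h : E) :
      B k h = w * ∑ i, inner ℝ (v i) k * inner ℝ (v i) h + lam * inner ℝ k h := by
    simp only [B, I]
    simp
    exact Or.inl rfl
  have hco : IsCoercive B := by
    refine ⟨lam, hlam, fun u => ?_⟩
    rw [hB, real_inner_self_eq_norm_sq]
    have : 0 ≤ w * ∑ i, inner ℝ (v i) u * inner ℝ (v i) u :=
      mul_nonneg hw (Finset.sum_nonneg fun i _ => mul_self_nonneg _)
    nlinarith
  set k₀ : E := hco.continuousLinearEquivOfBilin.symm (w • ∑ i, y i • v i) with hk₀
  have hnormal (h : E) : w * ∑ i, inner ℝ (v i) k₀ * inner ℝ (v i) h + lam * inner ℝ k₀ h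
      = w * ∑ i, y i * inner ℝ (v i) h := by
    rw [← hB, ← hco.continuousLinearEquivOfBilin_apply, hk₀,
      ContinuousLinearEquiv.apply_symm_apply, inner_smul_left, sum_inner]
    simp [inner_smul_left]
  -- The normal equations kill the linear term, so the excess over the value at `k₀` is a quadratic
  -- form bounded below by `lam * ‖k' - k₀‖ ^ 2`. This yields minimality and uniqueness together.
  have hexp (k' : E) : w * ∑ i, (y i - inner ℝ (v i) k') ^ 2 + lam * ‖k'‖ ^ 2
      = w * ∑ i, (y i - inner ℝ (v i) k₀) ^ 2 + lam * ‖k₀‖ ^ 2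
        + (w * ∑ i, inner ℝ (v i) (k' - k₀) ^ 2 + lam * ‖k' - k₀‖ ^ 2) := by
    obtain ⟨h, rfl⟩ : ∃ h, k' = k₀ + h := ⟨k' - k₀, by abel⟩
    have h1 : ∑ i, (y i - inner ℝ (v i) (k₀ + h)) ^ 2 = ∑ i, (y i - inner ℝ (v i) k₀) ^ 2
        + ∑ i, inner ℝ (v i) h ^ 2 - 2 * ∑ i, y i * inner ℝ (v i) h
        + 2 * ∑ i, inner ℝ (v i) k₀ * inner ℝ (v i) h := by
      simp only [Finset.mul_sum, ← Finset.sum_add_distrib, ← Finset.sum_sub_distrib]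
      refine Finset.sum_congr rfl fun i _ => ?_
      rw [inner_add_right]; ring
    have := hnormal h
    rw [h1, norm_add_sq_real, add_sub_cancel_left]
    linear_combination 2 * this
  have hpos (h : E) : 0 ≤ w * ∑ i, inner ℝ (v i) h ^ 2 :=
    mul_nonneg hw (Finset.sum_nonneg fun i _ => sq_nonneg _)
  refine ⟨k₀, fun k' => ?_, fun k hk => ?_⟩
  · rw [hexp k']
    have := hpos (k' - k₀)
    nlinarith [sq_nonneg ‖k' - k₀‖]
  · have h1 := hk k₀
    rw [hexp k] at h1
    have h2 := hpos (k - k₀)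
    have h3 : ‖k - k₀‖ ^ 2 ≤ 0 := by
      by_contra! hlt
      nlinarith [mul_pos hlam hlt]
    rw [← sub_eq_zero, ← norm_eq_zero]
    exact pow_eq_zero_iff two_ne_zero |>.1 (le_antisymm h3 (sq_nonneg _))

end LeastSquares

/-- The regularized empirical risk has a unique minimizer for every sample. -/
theorem existsUnique_isRegLSSolution [CompleteSpace H] {m : ℕ} {lam : ℝ} (hlam : 0 < lam)
    (z : (Fin m → X) × (Fin m × Fin m → ℝ)) : ∃! k : H, IsRegLSSolution lam z k := by
  have h := existsUnique_regularized_leastSquares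
    (fun ij : Fin m × Fin m => (RKHS.kerFun H (z.1 ij.1, z.1 ij.2) (1 : ℝ) : H)) z.2
    (w := 1 / (m : ℝ) ^ 2) (by positivity) hlam
  simpa only [inner_kerFun_one, Fintype.sum_prod_type, IsRegLSSolution, regEmpiricalRisk] using h

end Space

/-! ### Exponential moments and decoupling of pair averages -/

section ExponentialMarkov

/-- The exponential Markov inequality. -/
theorem measure_ge_le_of_lintegral_exp_le {Ω : Type*} [MeasurableSpace Ω] {μ : Measure Ω}
    {F : Ω → ℝ} (hF : Measurable F) {b : ℝ}
    (h : ∫⁻ ω, ENNReal.ofReal (Real.exp (F ω)) ∂μ ≤ ENNReal.ofReal (Real.exp b)) (L : ℝ) :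
    μ {ω | b + L ≤ F ω} ≤ ENNReal.ofReal (Real.exp (-L)) := by
  have h1 : {ω | b + L ≤ F ω}
      = {ω | ENNReal.ofReal (Real.exp (b + L)) ≤ ENNReal.ofReal (Real.exp (F ω))} := by
    ext ω
    simp [ENNReal.ofReal_le_ofReal_iff (Real.exp_pos _).le]
  rw [h1]
  refine (meas_ge_le_lintegral_div (by fun_prop) ?_ ENNReal.ofReal_ne_top).trans ?_
  · simp [Real.exp_pos]
  · rw [ENNReal.div_le_iff (by simp [Real.exp_pos]) ENNReal.ofReal_ne_top,
      ← ENNReal.ofReal_mul (Real.exp_pos _).le, ← Real.exp_add]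
    simpa using h

end ExponentialMarkov

section PiProduct

/-- The integral of a product of functions of single coordinates. -/
theorem lintegral_pi_prod {ι : Type*} [Fintype ι] {Ω : ι → Type*} [∀ i, MeasurableSpace (Ω i)]
    (μ : ∀ i, Measure (Ω i)) [∀ i, IsProbabilityMeasure (μ i)] (f : ∀ i, Ω i → ℝ≥0∞)
    (hf : ∀ i, Measurable (f i)) :
    ∫⁻ ω, ∏ i, f i (ω i) ∂Measure.pi μ = ∏ i, ∫⁻ x, f i x ∂μ i := by
  rw [lintegral_prod_eq_prod_lintegral_of_indepFun (μ := Measure.pi μ) Finset.univ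
    (fun i ω => f i (ω i)) (iIndepFun_pi (X := f) fun i => (hf i).aemeasurable)
    fun i => (hf i).comp (measurable_pi_apply i)]
  refine Finset.prod_congr rfl fun i _ => ?_
  exact (measurePreserving_eval μ i).lintegral_comp (hf i)

variable {X : Type u} [MeasurableSpace X]

/-- Reading a product measure along an injective family of disjoint pairs of coordinates. -/
theorem measurePreserving_pairs {m n : ℕ} (ρ : Measure X) [IsProbabilityMeasure ρ]
    (g : Fin n ⊕ Fin n → Fin m) (hg : Function.Injective g) :
    MeasurePreserving (fun (x : Fin m → X) (l : Fin n) => (x (g (.inl l)), x (g (.inr l))))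
      (Measure.pi fun _ => ρ) (Measure.pi fun _ => ρ.prod ρ) := by
  have h1 : MeasurePreserving (fun (x : Fin m → X) (l : Fin n ⊕ Fin n) => x (g l))
      (Measure.pi fun _ => ρ) (Measure.pi fun _ => ρ) := by
    refine ⟨by fun_prop, ?_⟩
    have hi : iIndepFun (fun i (ω : Fin m → X) => ω i) (Measure.pi fun _ => ρ) :=
      iIndepFun_pi (X := fun _ => id) fun i => aemeasurable_id
    have := (hi.precomp hg).map_fun_eq_pi_map fun i => (measurable_pi_apply _).aemeasurable
    rw [this]
    congr 1
    ext1 i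
    exact (measurePreserving_eval (fun _ => ρ) (g i)).map_eq
  have h2 := measurePreserving_sumPiEquivProdPi (fun _ : Fin n ⊕ Fin n => ρ)
  have h3 := (measurePreserving_arrowProdEquivProdArrow X X (Fin n) (fun _ => ρ)
    (fun _ => ρ)).symm
  exact h3.comp (h2.comp h1)

/-- Averaging over permutations: every off-diagonal pair is hit equally often. -/
theorem sum_perm_apply_pair {m : ℕ} (F : Fin m → Fin m → ℝ) {a b : Fin m} (hab : a ≠ b) :
    (m * (m - 1) : ℝ) * ∑ σ : Equiv.Perm (Fin m), F (σ a) (σ b)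
      = (Nat.factorial m : ℝ) * ∑ p ∈ (Finset.univ : Finset (Fin m)).offDiag, F p.1 p.2 := by
  -- Relabelling by a permutation that carries `(a, b)` to the given pair leaves the sum over all
  -- permutations unchanged; double counting does the rest.
  have hconst : ∀ p ∈ (Finset.univ : Finset (Fin m)).offDiag,
      ∑ σ : Equiv.Perm (Fin m), F (σ p.1) (σ p.2)
        = ∑ σ : Equiv.Perm (Fin m), F (σ a) (σ b) := by
    rintro ⟨i, j⟩ hp
    have hij : i ≠ j := by simpa using hp
    obtain ⟨τ, hτa, hτb⟩ : ∃ τ : Equiv.Perm (Fin m), τ a = i ∧ τ b = j := by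
      -- The first swap sends `a` to `i`; the second sends the current image of `b` to `j` and
      -- leaves `i` fixed.
      refine ⟨(Equiv.swap a i).trans (Equiv.swap (Equiv.swap a i b) j), ?_, ?_⟩
      · simp only [Equiv.trans_apply, Equiv.swap_apply_left]
        refine Equiv.swap_apply_of_ne_of_ne ?_ hij
        intro h
        exact hab ((Equiv.swap a i).injective (by rw [Equiv.swap_apply_left]; exact h))
      · simp
    simp only
    rw [← hτa, ← hτb]
    exact Fintype.sum_equiv (Equiv.mulRight τ) _ _ fun σ => by simp
  have hinv (σ : Equiv.Perm (Fin m)) :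
      ∑ p ∈ (Finset.univ : Finset (Fin m)).offDiag, F (σ p.1) (σ p.2)
        = ∑ p ∈ (Finset.univ : Finset (Fin m)).offDiag, F p.1 p.2 :=
    Finset.sum_bij' (fun p _ => (σ p.1, σ p.2)) (fun p _ => (σ.symm p.1, σ.symm p.2))
      (by simp) (by simp) (by simp) (by simp) (by simp)
  have hcard : ((Finset.univ : Finset (Fin m)).offDiag.card : ℝ) = m * (m - 1) := by
    rw [Finset.offDiag_card, Finset.card_univ, Fintype.card_fin, Nat.cast_sub (Nat.le_mul_self m)]
    push_cast; ring
  calc (m * (m - 1) : ℝ) * ∑ σ : Equiv.Perm (Fin m), F (σ a) (σ b)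
      = ∑ p ∈ (Finset.univ : Finset (Fin m)).offDiag,
          ∑ σ : Equiv.Perm (Fin m), F (σ p.1) (σ p.2) := by
        rw [Finset.sum_congr rfl hconst, Finset.sum_const, nsmul_eq_mul, hcard]
    _ = _ := by
        rw [Finset.sum_comm, Finset.sum_congr rfl fun σ _ => hinv σ, Finset.sum_const,
          nsmul_eq_mul, Finset.card_univ, Fintype.card_perm, Fintype.card_fin]

/-- The off-diagonal average of `f` over the pairs of a sample. -/
noncomputable def pairAverage {m : ℕ} (f : X × X → ℝ) (x : Fin m → X) : ℝ :=
  1 / (m * (m - 1) : ℝ) * ∑ p ∈ (Finset.univ : Finset (Fin m)).offDiag, f (x p.1, x p.2)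

theorem measurable_pairAverage {m : ℕ} {f : X × X → ℝ} (hf : Measurable f) :
    Measurable (pairAverage f : (Fin m → X) → ℝ) := by
  unfold pairAverage
  fun_prop

/-- Hoeffding's decoupling of pair averages: exponential moments of a U-statistic of order two are
dominated by those of an average over `m / 2` independent pairs. -/
theorem lintegral_exp_pairAverage_le {m : ℕ} (hm : 2 ≤ m) (ρ : Measure X) [IsProbabilityMeasure ρ]
    {f : X × X → ℝ} (hf : Measurable f) :
    ∫⁻ x : Fin m → X, ENNReal.ofReal (Real.exp ((m / 2 : ℕ) * pairAverage f x))
        ∂(Measure.pi fun _ => ρ)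
      ≤ (∫⁻ p, ENNReal.ofReal (Real.exp (f p)) ∂(ρ.prod ρ)) ^ (m / 2) := by
  set n := m / 2 with hn
  -- The disjoint pairs (2l, 2l + 1); for odd `m` the last index is left out.
  let g : Fin n ⊕ Fin n → Fin m :=
    Sum.elim (fun l => ⟨2 * l, by omega⟩) (fun l => ⟨2 * l + 1, by omega⟩)
  have hg : Function.Injective g := by
    rintro (l | l) (k | k) h <;> simp [g, Fin.ext_iff] at h ⊢ <;> omega
  let W (σ : Equiv.Perm (Fin m)) (x : Fin m → X) : ℝ :=
    ∑ l : Fin n, f (x (σ (g (.inl l))), x (σ (g (.inr l))))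
  have hm0 : (m * (m - 1) : ℝ) ≠ 0 := by
    have : (2 : ℝ) ≤ m := by exact_mod_cast hm
    exact mul_ne_zero (by linarith) (by linarith)
  have hfac : (0 : ℝ) < Nat.factorial m := by exact_mod_cast Nat.factorial_pos m
  have havg (x : Fin m → X) :
      n * pairAverage f x = ∑ σ : Equiv.Perm (Fin m), (1 / (Nat.factorial m : ℝ)) * W σ x := by
    have h1 (l : Fin n) : ∑ σ : Equiv.Perm (Fin m), f (x (σ (g (.inl l))), x (σ (g (.inr l))))
        = Nat.factorial m * pairAverage f x := by
      have := sum_perm_apply_pair (fun a b => f (x a, x b))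
        (hg.ne (by simp : (Sum.inl l : Fin n ⊕ Fin n) ≠ .inr l))
      rw [pairAverage, mul_left_comm, ← this, ← mul_assoc, one_div_mul_cancel hm0, one_mul]
    simp only [W]
    rw [← Finset.mul_sum, Finset.sum_comm, Finset.sum_congr rfl fun l _ => h1 l]
    simp
    field_simp
  -- Each `W σ` is a sum over independent pairs; convexity of `exp` lets the average over
  -- permutations, whose terms are mutually dependent, be treated one term at a time.
  have hjensen (x : Fin m → X) : Real.exp (n * pairAverage f x)
      ≤ ∑ σ : Equiv.Perm (Fin m), (1 / (Nat.factorial m : ℝ)) * Real.exp (W σ x) := by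
    rw [havg]
    exact convexOn_exp.map_sum_le (fun _ _ => by positivity)
      (by simp [Fintype.card_perm, hfac.ne']) (fun _ _ => Set.mem_univ _)
  have hW (σ : Equiv.Perm (Fin m)) :
      ∫⁻ x : Fin m → X, ENNReal.ofReal (Real.exp (W σ x)) ∂(Measure.pi fun _ => ρ)
        = (∫⁻ p, ENNReal.ofReal (Real.exp (f p)) ∂(ρ.prod ρ)) ^ n := by
    have h1 (x : Fin m → X) : ENNReal.ofReal (Real.exp (W σ x))
        = ∏ l : Fin n, ENNReal.ofReal (Real.exp
          (f (x (σ (g (.inl l))), x (σ (g (.inr l)))))) := by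
      rw [Real.exp_sum, ENNReal.ofReal_prod_of_nonneg fun _ _ => (Real.exp_pos _).le]
    have h2 := measurePreserving_pairs ρ (fun l => σ (g l)) (σ.injective.comp hg)
    have hmeas : Measurable fun p => ENNReal.ofReal (Real.exp (f p)) := by fun_prop
    have h3 := h2.lintegral_comp (f := fun w : Fin n → X × X =>
      ∏ l, ENNReal.ofReal (Real.exp (f (w l)))) (by fun_prop)
    simp_rw [h1]
    rw [h3, lintegral_pi_prod _ (fun _ p => ENNReal.ofReal (Real.exp (f p))) fun _ => hmeas]
    simp
  have hWm (σ : Equiv.Perm (Fin m)) : Measurable (W σ) := by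
    simp only [W]; fun_prop
  calc _ ≤ ∫⁻ x : Fin m → X, ∑ σ : Equiv.Perm (Fin m),
        ENNReal.ofReal (1 / (Nat.factorial m : ℝ)) * ENNReal.ofReal (Real.exp (W σ x))
        ∂(Measure.pi fun _ => ρ) := by
        refine lintegral_mono fun x => ?_
        refine (ENNReal.ofReal_le_ofReal (hjensen x)).trans (le_of_eq ?_)
        rw [ENNReal.ofReal_sum_of_nonneg fun _ _ => by positivity]
        exact Finset.sum_congr rfl fun σ _ => ENNReal.ofReal_mul (by positivity)
    _ = _ := by
        rw [lintegral_finsetSum _ fun σ _ => by have := hWm σ; fun_prop]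
        rw [Finset.sum_congr rfl fun σ _ => by
          rw [lintegral_const_mul _ (by have := hWm σ; fun_prop), hW σ]]
        rw [Finset.sum_const, Finset.card_univ, Fintype.card_perm, Fintype.card_fin, nsmul_eq_mul,
          ← mul_assoc, ← ENNReal.ofReal_natCast, ← ENNReal.ofReal_mul (by positivity)]
        rw [mul_one_div_cancel hfac.ne', ENNReal.ofReal_one, one_mul]

end PiProduct

/-! ### Chernoff bounds for pair averages -/

section Chernoff

variable {X : Type u}

/-- Equality holds at m = 3. This loss from keeping only ⌊m/2⌋ pairs produces the constants 3 and 6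
in the two Chernoff bounds. -/
theorem third_le_half {m : ℕ} (hm : 2 ≤ m) : (m : ℝ) ≤ 3 * (m / 2 : ℕ) := by
  exact_mod_cast (by omega : m ≤ 3 * (m / 2))

theorem pairAverage_const_mul {m : ℕ} (a : ℝ) (f : X × X → ℝ) (x : Fin m → X) :
    pairAverage (fun p => a * f p) x = a * pairAverage f x := by
  simp only [pairAverage, ← Finset.mul_sum]; ring

variable [MeasurableSpace X] (ρ : Measure X) [IsProbabilityMeasure ρ]

/-- Upper Chernoff bound for pair averages of bounded nonnegative functions. -/
theorem measure_pairAverage_ge_le {m : ℕ} (hm : 2 ≤ m) {h : X × X → ℝ} (hh : Measurable h) {B : ℝ}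
    (hB : 0 < B) (h0 : ∀ p, 0 ≤ h p) (h1 : ∀ p, h p ≤ B) {L : ℝ} (hL : 0 ≤ L) :
    (Measure.pi fun _ : Fin m => ρ)
        {x | 2 * ∫ p, h p ∂(ρ.prod ρ) + 3 * B * L / m ≤ pairAverage h x}
      ≤ ENNReal.ofReal (Real.exp (-L)) := by
  set V := ∫ p, h p ∂(ρ.prod ρ) with hV
  have hint : Integrable h (ρ.prod ρ) := Integrable.of_bound hh.aestronglyMeasurable B
    (ae_of_all _ fun p => by rw [Real.norm_of_nonneg (h0 p)]; exact h1 p)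
  -- On [0, 1] one has exp u ≤ 1 + u + u² ≤ 1 + 2u, so the mean alone controls the exponential
  -- moment. The price is the factor 2 before `V`; the gain is a deviation of order L/m.
  have hmgf : ∫⁻ p, ENNReal.ofReal (Real.exp (B⁻¹ * h p)) ∂(ρ.prod ρ)
      ≤ ENNReal.ofReal (Real.exp (2 * (B⁻¹ * V))) := by
    calc _ ≤ ∫⁻ p, ENNReal.ofReal (1 + 2 * (B⁻¹ * h p)) ∂(ρ.prod ρ) := by
          refine lintegral_mono fun p => ENNReal.ofReal_le_ofReal ?_
          have hu0 : 0 ≤ B⁻¹ * h p := mul_nonneg (by positivity) (h0 p)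
          have hu1 : B⁻¹ * h p ≤ 1 := by
            rw [inv_mul_le_iff₀ hB, mul_one]; exact h1 p
          have := (abs_le.1 (Real.abs_exp_sub_one_sub_id_le (by rwa [abs_of_nonneg hu0]))).2
          nlinarith
      _ = ENNReal.ofReal (∫ p, (1 + 2 * (B⁻¹ * h p)) ∂(ρ.prod ρ)) := by
          rw [ofReal_integral_eq_lintegral_ofReal]
          · exact (integrable_const _).add ((hint.const_mul _).const_mul _)
          · exact ae_of_all _ fun p => by have := h0 p; positivity
      _ ≤ _ := by
          refine ENNReal.ofReal_le_ofReal ?_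
          rw [integral_add (integrable_const _) ((hint.const_mul _).const_mul _),
            integral_const_mul, integral_const_mul]
          simp only [integral_const, probReal_univ, smul_eq_mul, one_mul]
          linarith [Real.add_one_le_exp (2 * (B⁻¹ * V))]
  have hm0 : (0 : ℝ) < m := by exact_mod_cast (by omega : 0 < m)
  have hpi : ∫⁻ x : Fin m → X, ENNReal.ofReal (Real.exp ((m / 2 : ℕ) * (B⁻¹ * pairAverage h x)))
        ∂(Measure.pi fun _ => ρ)
      ≤ ENNReal.ofReal (Real.exp ((m / 2 : ℕ) * (2 * (B⁻¹ * V)))) := by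
    simp_rw [← pairAverage_const_mul (_⁻¹)]
    refine (lintegral_exp_pairAverage_le hm ρ (hh.const_mul _)).trans ?_
    grw [hmgf]
    rw [← ENNReal.ofReal_pow (Real.exp_pos _).le, ← Real.exp_nat_mul]
  refine le_trans (measure_mono fun x hx => ?_) (measure_ge_le_of_lintegral_exp_le
    (by have := measurable_pairAverage (m := m) hh; fun_prop) hpi L)
  simp only [Set.mem_ofPred_eq] at hx ⊢
  have h3 := third_le_half hm
  have h4 : (m / 2 : ℕ) * (B⁻¹ * (2 * V + 3 * B * L / m))
      ≤ (m / 2 : ℕ) * (B⁻¹ * pairAverage h x) := by gcongr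
  refine le_trans ?_ h4
  have h5 : ((m / 2 : ℕ) : ℝ) * (B⁻¹ * (2 * V + 3 * B * L / m))
      = (m / 2 : ℕ) * (2 * (B⁻¹ * V)) + L * (3 * (m / 2 : ℕ) / m) := by field_simp
  rw [h5]
  have h6 : 1 ≤ 3 * ((m / 2 : ℕ) : ℝ) / m := by rwa [le_div_iff₀ hm0, one_mul]
  nlinarith

/-- Lower Chernoff bound for pair averages of bounded nonnegative functions. -/
theorem measure_pairAverage_le_le {m : ℕ} (hm : 2 ≤ m) {h : X × X → ℝ} (hh : Measurable h) {B : ℝ}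
    (hB : 0 < B) (h0 : ∀ p, 0 ≤ h p) (h1 : ∀ p, h p ≤ B) {L : ℝ} (hL : 0 ≤ L) :
    (Measure.pi fun _ : Fin m => ρ)
        {x | 2 * pairAverage h x + 6 * B * L / m ≤ ∫ p, h p ∂(ρ.prod ρ)}
      ≤ ENNReal.ofReal (Real.exp (-L)) := by
  set V := ∫ p, h p ∂(ρ.prod ρ) with hV
  have hint : Integrable h (ρ.prod ρ) := Integrable.of_bound hh.aestronglyMeasurable B
    (ae_of_all _ fun p => by rw [Real.norm_of_nonneg (h0 p)]; exact h1 p)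
  have hmgf : ∫⁻ p, ENNReal.ofReal (Real.exp (-B⁻¹ * h p)) ∂(ρ.prod ρ)
      ≤ ENNReal.ofReal (Real.exp (-(B⁻¹ * V / 2))) := by
    have hu (p) : 0 ≤ B⁻¹ * h p ∧ B⁻¹ * h p ≤ 1 :=
      ⟨mul_nonneg (by positivity) (h0 p), by rw [inv_mul_le_iff₀ hB, mul_one]; exact h1 p⟩
    calc _ ≤ ∫⁻ p, ENNReal.ofReal (1 - B⁻¹ * h p / 2) ∂(ρ.prod ρ) := by
          refine lintegral_mono fun p => ENNReal.ofReal_le_ofReal ?_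
          obtain ⟨hu0, hu1⟩ := hu p
          -- For u in [0, 1], (1 + u)(1 - u/2) ≥ 1, so exp u ≥ 1 + u gives exp(-u) ≤ 1 - u/2.
          rw [neg_mul, Real.exp_neg]
          refine inv_le_of_inv_le₀ (by linarith) ?_
          refine le_trans ?_ (Real.add_one_le_exp _)
          rw [inv_le_iff_one_le_mul₀ (by linarith)]
          nlinarith
      _ = ENNReal.ofReal (∫ p, (1 - B⁻¹ * h p / 2) ∂(ρ.prod ρ)) := by
          rw [ofReal_integral_eq_lintegral_ofReal]
          · exact (integrable_const _).sub ((hint.const_mul _).div_const _)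
          · exact ae_of_all _ fun p => by
              have := (hu p).2
              simp only [Pi.zero_apply]; linarith
      _ ≤ _ := by
          refine ENNReal.ofReal_le_ofReal ?_
          rw [integral_sub (integrable_const _) ((hint.const_mul _).div_const _),
            integral_div, integral_const_mul]
          simp only [integral_const, probReal_univ, smul_eq_mul, one_mul]
          linarith [Real.add_one_le_exp (-(B⁻¹ * V / 2))]
  have hm0 : (0 : ℝ) < m := by exact_mod_cast (by omega : 0 < m)
  have hpi : ∫⁻ x : Fin m → X, ENNReal.ofReal (Real.exp ((m / 2 : ℕ) * (-B⁻¹ * pairAverage h x)))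
        ∂(Measure.pi fun _ => ρ)
      ≤ ENNReal.ofReal (Real.exp ((m / 2 : ℕ) * -(B⁻¹ * V / 2))) := by
    simp_rw [← pairAverage_const_mul (-_⁻¹)]
    refine (lintegral_exp_pairAverage_le hm ρ (hh.const_mul _)).trans ?_
    grw [hmgf]
    rw [← ENNReal.ofReal_pow (Real.exp_pos _).le, ← Real.exp_nat_mul]
  refine le_trans (measure_mono fun x hx => ?_) (measure_ge_le_of_lintegral_exp_le
    (by have := measurable_pairAverage (m := m) hh; fun_prop) hpi L)
  simp only [Set.mem_ofPred_eq] at hx ⊢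
  have h3 := third_le_half hm
  have h4 : (m / 2 : ℕ) * (B⁻¹ / 2 * (2 * pairAverage h x + 6 * B * L / m))
      ≤ (m / 2 : ℕ) * (B⁻¹ / 2 * V) := by gcongr
  have h5 : ((m / 2 : ℕ) : ℝ) * (B⁻¹ / 2 * (2 * pairAverage h x + 6 * B * L / m))
      = (m / 2 : ℕ) * (B⁻¹ * pairAverage h x) + L * (3 * (m / 2 : ℕ) / m) := by field_simp; ring
  rw [h5] at h4
  have h6 : 1 ≤ 3 * ((m / 2 : ℕ) : ℝ) / m := by rwa [le_div_iff₀ hm0, one_mul]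
  nlinarith

end Chernoff

/-! ### Exponential moments of the outputs -/

section Moments

variable {X : Type u} [MeasurableSpace X] {κ : Kernel (X × X) ℝ} {c M : ℝ}

theorem MomentHypothesis.integrable_abs_pow (hmoment : MomentHypothesis κ c M) {ℓ : ℕ}
    (hℓ : 1 ≤ ℓ) (p : X × X) : Integrable (fun y => |y| ^ ℓ) (κ p) := by
  refine ⟨by fun_prop, ?_⟩
  rw [hasFiniteIntegral_iff_ofReal (ae_of_all _ fun y => by positivity)]
  exact (hmoment ℓ hℓ p).trans_lt ENNReal.ofReal_lt_top

theorem MomentHypothesis.integrable_id (hmoment : MomentHypothesis κ c M) (p : X × X) :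
    Integrable (fun y => y) (κ p) := by
  have := hmoment.integrable_abs_pow le_rfl p
  simp only [pow_one] at this
  exact (integrable_norm_iff (by fun_prop)).1 this

/-- Unlike an almost-everywhere bound for ρX × ρX, this bound also covers the diagonal pairs (x_i,
x_i), which may lie in a null set. -/
theorem MomentHypothesis.abs_target_le (hmoment : MomentHypothesis κ c M) (hM : 1 ≤ M)
    (hc : 0 < c) (p : X × X) : |target κ p| ≤ c * M := by
  have h1 : |target κ p| ≤ ∫ y, |y| ∂(κ p) := abs_integral_le_integral_abs
  refine h1.trans ?_
  rw [integral_eq_lintegral_of_nonneg_ae (ae_of_all _ fun y => abs_nonneg y) (by fun_prop)]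
  refine ENNReal.toReal_le_of_le_ofReal (by positivity) ?_
  simpa using hmoment 1 le_rfl p

theorem measurable_target : Measurable (target κ) :=
  (StronglyMeasurable.integral_kernel (f := fun y : ℝ => y) stronglyMeasurable_id).measurable

variable [IsMarkovKernel κ]

/-- The moment hypothesis bounds an exponential moment. -/
theorem MomentHypothesis.lintegral_exp_abs_le (hmoment : MomentHypothesis κ c M) (hM : 1 ≤ M)
    (hc : 0 < c) (p : X × X) :
    ∫⁻ y, ENNReal.ofReal (Real.exp (|y| / (2 * M))) ∂(κ p) ≤ ENNReal.ofReal (1 + c) := by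
  have hexp (y : ℝ) : ENNReal.ofReal (Real.exp (|y| / (2 * M)))
      = ∑' ℓ : ℕ, ENNReal.ofReal ((|y| / (2 * M)) ^ ℓ / ℓ.factorial) := by
    rw [Real.exp_eq_exp_ℝ, NormedSpace.exp_eq_tsum_div,
      ENNReal.ofReal_tsum_of_nonneg (fun ℓ => by positivity) (Real.summable_pow_div_factorial _)]
  simp_rw [hexp]
  rw [lintegral_tsum fun ℓ => by fun_prop, tsum_eq_zero_add' ENNReal.summable]
  -- At scale 2M the factorials and the powers of M cancel, leaving a geometric series of sum c. The
  -- index is shifted because the moment hypothesis starts at ℓ = 1.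
  have hterm (ℓ : ℕ) : ∫⁻ y, ENNReal.ofReal ((|y| / (2 * M)) ^ (ℓ + 1) / (ℓ + 1).factorial) ∂(κ p)
      ≤ ENNReal.ofReal (c / 2 / 2 ^ ℓ) := by
    have h1 (y : ℝ) : ENNReal.ofReal ((|y| / (2 * M)) ^ (ℓ + 1) / (ℓ + 1).factorial)
        = ENNReal.ofReal (1 / ((2 * M) ^ (ℓ + 1) * (ℓ + 1).factorial))
          * ENNReal.ofReal (|y| ^ (ℓ + 1)) := by
      rw [← ENNReal.ofReal_mul (by positivity)]
      congr 1
      rw [div_pow]; field_simp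
    simp_rw [h1]
    rw [lintegral_const_mul _ (by fun_prop)]
    grw [hmoment (ℓ + 1) (by omega) p]
    rw [← ENNReal.ofReal_mul (by positivity)]
    refine ENNReal.ofReal_le_ofReal (le_of_eq ?_)
    rw [mul_pow, pow_succ 2 ℓ]
    have : ((ℓ + 1).factorial : ℝ) ≠ 0 := by positivity
    field_simp
  calc _ ≤ 1 + ∑' ℓ : ℕ, ENNReal.ofReal (c / 2 / 2 ^ ℓ) := by
        gcongr with ℓ
        · simp
        · exact hterm ℓ
    _ = _ := by
        rw [← ENNReal.ofReal_tsum_of_nonneg (fun ℓ => by positivity) (summable_geometric_two' c),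
          tsum_geometric_two', ENNReal.ofReal_add zero_le_one hc.le, ENNReal.ofReal_one]

theorem MomentHypothesis.integrable_exp_abs (hmoment : MomentHypothesis κ c M) (hM : 1 ≤ M)
    (hc : 0 < c) (p : X × X) : Integrable (fun y => Real.exp (|y| / (2 * M))) (κ p) := by
  refine ⟨by fun_prop, ?_⟩
  rw [hasFiniteIntegral_iff_ofReal (ae_of_all _ fun y => (Real.exp_pos _).le)]
  exact (hmoment.lintegral_exp_abs_le hM hc p).trans_lt ENNReal.ofReal_lt_top

theorem MomentHypothesis.integral_exp_abs_le (hmoment : MomentHypothesis κ c M) (hM : 1 ≤ M)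
    (hc : 0 < c) (p : X × X) : ∫ y, Real.exp (|y| / (2 * M)) ∂(κ p) ≤ 1 + c := by
  rw [integral_eq_lintegral_of_nonneg_ae (ae_of_all _ fun y => (Real.exp_pos _).le) (by fun_prop)]
  exact ENNReal.toReal_le_of_le_ofReal (by positivity) (hmoment.lintegral_exp_abs_le hM hc p)

/-- Centered outputs have subgaussian exponential moments below a fixed scale. -/
theorem MomentHypothesis.lintegral_exp_centered_le (hmoment : MomentHypothesis κ c M) (hM : 1 ≤ M)
    (hc : 0 < c) (p : X × X) {θ : ℝ} (hθ : |θ| ≤ 1 / (4 * M)) :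
    ∫⁻ y, ENNReal.ofReal (Real.exp (θ * (y - target κ p))) ∂(κ p)
      ≤ ENNReal.ofReal (Real.exp (32 * M ^ 2 * Real.exp (c / 2) * (1 + c) * θ ^ 2)) := by
  set t := target κ p with ht
  set C := 32 * M ^ 2 * Real.exp (c / 2) with hC
  have hM0 : 0 < M := by linarith
  have hid := hmoment.integrable_id p
  have hE := hmoment.integrable_exp_abs hM hc p
  -- The linear term integrates to zero. In the remainder, ξ² and exp |θξ| each cost one factor
  -- exp(|ξ|/(4M)), together exp(|ξ|/(2M)), which is integrable; 32 is 2! · 4², and exp(c/2) pays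
  -- for the centering.
  have hpt (y : ℝ) : Real.exp (θ * (y - t))
      ≤ 1 + θ * (y - t) + C * θ ^ 2 * Real.exp (|y| / (2 * M)) := by
    have h1 (u : ℝ) : Real.exp u ≤ 1 + u + u ^ 2 * Real.exp |u| := by
      have := Complex.norm_exp_sub_sum_le_norm_mul_exp (u : ℂ) 2
      simp only [Finset.sum_range_succ, Finset.range_zero, Finset.sum_empty, pow_zero, pow_one,
        Nat.factorial, Nat.cast_one, div_one, zero_add, mul_one] at this
      rw [← Complex.ofReal_exp, ← Complex.ofReal_one, ← Complex.ofReal_add, ← Complex.ofReal_sub,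
        Complex.norm_real, Complex.norm_real, Real.norm_eq_abs, Real.norm_eq_abs, sq_abs] at this
      linarith [(abs_le.1 this).2]
    refine (h1 _).trans (add_le_add_right ?_ _)
    set ξ := y - t
    have h2 : ξ ^ 2 ≤ 32 * M ^ 2 * Real.exp (|ξ| / (4 * M)) := by
      have := Real.pow_div_factorial_le_exp (|ξ| / (4 * M)) (by positivity) 2
      rw [div_pow, sq_abs, div_div, div_le_iff₀ (by positivity)] at this
      norm_num [Nat.factorial] at this
      nlinarith
    have h3 : |θ * ξ| ≤ |ξ| / (4 * M) := by
      rw [abs_mul]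
      calc |θ| * |ξ| ≤ 1 / (4 * M) * |ξ| := by gcongr
        _ = _ := by ring
    have h4 : |ξ| ≤ |y| + c * M :=
      (abs_sub _ _).trans (by gcongr; exact hmoment.abs_target_le hM hc p)
    calc (θ * ξ) ^ 2 * Real.exp |θ * ξ|
        ≤ θ ^ 2 * (32 * M ^ 2 * Real.exp (|ξ| / (4 * M))) * Real.exp (|ξ| / (4 * M)) := by
          rw [mul_pow]; gcongr
      _ = 32 * M ^ 2 * θ ^ 2 * Real.exp (|ξ| / (4 * M) + |ξ| / (4 * M)) := by
          rw [Real.exp_add]; ring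
      _ ≤ 32 * M ^ 2 * θ ^ 2 * Real.exp (c / 2 + |y| / (2 * M)) := by
          refine mul_le_mul_of_nonneg_left (Real.exp_le_exp.2 ?_) (by positivity)
          have : |ξ| / (4 * M) + |ξ| / (4 * M) = |ξ| / (2 * M) := by ring
          rw [this, div_le_iff₀ (by positivity)]
          have : (c / 2 + |y| / (2 * M)) * (2 * M) = |y| + c * M := by field_simp; ring
          linarith
      _ = C * θ ^ 2 * Real.exp (|y| / (2 * M)) := by rw [Real.exp_add, hC]; ring
  have hi0 : Integrable (fun y => y - t) (κ p) := hid.sub (integrable_const _)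
  have hi1 : Integrable (fun y => 1 + θ * (y - t)) (κ p) :=
    (integrable_const _).add (hi0.const_mul _)
  have hi2 : Integrable (fun y => C * θ ^ 2 * Real.exp (|y| / (2 * M))) (κ p) := hE.const_mul _
  calc _ ≤ ∫⁻ y, ENNReal.ofReal (1 + θ * (y - t) + C * θ ^ 2 * Real.exp (|y| / (2 * M))) ∂(κ p) :=
        lintegral_mono fun y => ENNReal.ofReal_le_ofReal (hpt y)
    _ = ENNReal.ofReal (∫ y, (1 + θ * (y - t) + C * θ ^ 2 * Real.exp (|y| / (2 * M))) ∂(κ p)) := by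
        refine (ofReal_integral_eq_lintegral_ofReal (hi1.add hi2) ?_).symm
        exact ae_of_all _ fun y => (Real.exp_pos _).le.trans (hpt y)
    _ ≤ _ := by
        refine ENNReal.ofReal_le_ofReal ?_
        rw [integral_add hi1 hi2, integral_add (integrable_const _)
          (hi0.const_mul _), integral_const_mul, integral_const_mul,
          integral_sub hid (integrable_const _)]
        have h5 : ∫ y, y ∂(κ p) = t := rfl
        simp only [integral_const, probReal_univ, smul_eq_mul, one_mul, h5, sub_self, mul_zero,
          add_zero]
        have h6 := mul_le_mul_of_nonneg_left (hmoment.integral_exp_abs_le hM hc p)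
          (by positivity : 0 ≤ C * θ ^ 2)
        have h7 := Real.add_one_le_exp (C * (1 + c) * θ ^ 2)
        linarith

/-- Controls the mean absolute noise, against which the sup-norm error of a net is paired. -/
theorem MomentHypothesis.lintegral_exp_abs_centered_le (hmoment : MomentHypothesis κ c M)
    (hM : 1 ≤ M) (hc : 0 < c) (p : X × X) :
    ∫⁻ y, ENNReal.ofReal (Real.exp (1 / (2 * M) * |y - target κ p|)) ∂(κ p)
      ≤ ENNReal.ofReal (Real.exp (2 * c)) := by
  have hM0 : 0 < M := by linarith
  calc _ ≤ ∫⁻ y, ENNReal.ofReal (Real.exp (c / 2)) * ENNReal.ofReal (Real.exp (|y| / (2 * M)))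
        ∂(κ p) := by
        refine lintegral_mono fun y => ?_
        rw [← ENNReal.ofReal_mul (Real.exp_pos _).le, ← Real.exp_add]
        refine ENNReal.ofReal_le_ofReal (Real.exp_le_exp.2 ?_)
        have h4 : |y - target κ p| ≤ |y| + c * M :=
          (abs_sub _ _).trans (by gcongr; exact hmoment.abs_target_le hM hc p)
        calc 1 / (2 * M) * |y - target κ p| ≤ 1 / (2 * M) * (|y| + c * M) := by gcongr
          _ = _ := by field_simp; ring
    _ ≤ ENNReal.ofReal (Real.exp (c / 2)) * ENNReal.ofReal (1 + c) := by
        rw [lintegral_const_mul _ (by fun_prop)]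
        gcongr
        exact hmoment.lintegral_exp_abs_le hM hc p
    _ ≤ _ := by
        rw [← ENNReal.ofReal_mul (Real.exp_pos _).le]
        refine ENNReal.ofReal_le_ofReal ?_
        calc Real.exp (c / 2) * (1 + c) ≤ Real.exp (c / 2) * Real.exp c := by
              gcongr; linarith [Real.add_one_le_exp c]
          _ ≤ _ := by rw [← Real.exp_add]; gcongr; linarith

end Moments

/-! ### Noise concentration under the sampling law, and the excess risk -/

section Sample

variable {X : Type u} [MeasurableSpace X] {ρX : Measure X} [IsProbabilityMeasure ρX]
  {κ : Kernel (X × X) ℝ} [IsMarkovKernel κ] {m : ℕ}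

/-- Events that only concern the inputs have their probability under the input law. -/
theorem sampleLaw_preimage_fst {S : Set (Fin m → X)} (hS : MeasurableSet S) :
    sampleLaw ρX κ m {z | z.1 ∈ S} = (Measure.pi fun _ => ρX) S := by
  have h := Measure.fst_apply (ρ := sampleLaw ρX κ m) hS
  rw [sampleLaw, Measure.fst_compProd] at h
  exact h.symm

/-- The centered output attached to the pair `ij`. -/
noncomputable def noise (κ : Kernel (X × X) ℝ) (z : (Fin m → X) × (Fin m × Fin m → ℝ))
    (ij : Fin m × Fin m) : ℝ :=
  z.2 ij - target κ (z.1 ij.1, z.1 ij.2)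

/-- Exponential moments of sums over the outputs tensorize. -/
theorem lintegral_exp_sum_le {φ : X × X → ℝ → ℝ} (hφ : Measurable (Function.uncurry φ)) {b : ℝ}
    (h : ∀ p, ∫⁻ y, ENNReal.ofReal (Real.exp (φ p y)) ∂(κ p) ≤ ENNReal.ofReal (Real.exp b)) :
    ∫⁻ z, ENNReal.ofReal (Real.exp (∑ ij, φ (z.1 ij.1, z.1 ij.2) (z.2 ij))) ∂(sampleLaw ρX κ m)
      ≤ ENNReal.ofReal (Real.exp (m ^ 2 * b)) := by
  have hz (ij : Fin m × Fin m) : Measurable fun z : (Fin m → X) × (Fin m × Fin m → ℝ) =>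
      φ (z.1 ij.1, z.1 ij.2) (z.2 ij) :=
    hφ.comp (f := fun z : (Fin m → X) × (Fin m × Fin m → ℝ) =>
      ((z.1 ij.1, z.1 ij.2), z.2 ij)) (by fun_prop)
  rw [sampleLaw, Measure.lintegral_compProd (by fun_prop)]
  calc _ ≤ ∫⁻ _ : Fin m → X, ENNReal.ofReal (Real.exp (m ^ 2 * b)) ∂(Measure.pi fun _ => ρX) := by
        refine lintegral_mono fun x => ?_
        have h1 (y : Fin m × Fin m → ℝ) :
            ENNReal.ofReal (Real.exp (∑ ij, φ (x ij.1, x ij.2) (y ij)))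
              = ∏ ij, ENNReal.ofReal (Real.exp (φ (x ij.1, x ij.2) (y ij))) := by
          rw [Real.exp_sum, ENNReal.ofReal_prod_of_nonneg fun _ _ => (Real.exp_pos _).le]
        simp only [h1]
        have h2 (ij : Fin m × Fin m) :
            Measurable fun y => ENNReal.ofReal (Real.exp (φ (x ij.1, x ij.2) y)) :=
          (Real.measurable_exp.comp (hφ.comp measurable_prodMk_left)).ennreal_ofReal
        change ∫⁻ y, _ ∂(Measure.pi fun ij : Fin m × Fin m => κ (x ij.1, x ij.2)) ≤ _
        rw [lintegral_pi_prod (fun ij : Fin m × Fin m => κ (x ij.1, x ij.2))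
          (fun ij y => ENNReal.ofReal (Real.exp (φ (x ij.1, x ij.2) y))) h2]
        refine (Finset.prod_le_prod' fun ij _ => h _).trans (le_of_eq ?_)
        rw [Finset.prod_const, Finset.card_univ, Fintype.card_prod, Fintype.card_fin,
          ← ENNReal.ofReal_pow (Real.exp_pos _).le, ← Real.exp_nat_mul]
        push_cast
        rw [sq]
    _ = _ := by simp

variable {c M : ℝ}

/-- The average of the absolute centered outputs is bounded with high probability. -/
theorem MomentHypothesis.measure_sum_abs_noise_ge_le (hmoment : MomentHypothesis κ c M)
    (hM : 1 ≤ M) (hc : 0 < c) {L : ℝ} (hL : L ≤ (m : ℝ) ^ 2) :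
    sampleLaw ρX κ m {z | 2 * M * (2 * c + 1) * m ^ 2 ≤ ∑ ij, |noise κ z ij|}
      ≤ ENNReal.ofReal (Real.exp (-L)) := by
  have hM0 : 0 < M := by linarith
  have ht := measurable_target (κ := κ)
  have h := lintegral_exp_sum_le (ρX := ρX) (κ := κ) (m := m)
    (φ := fun p y => 1 / (2 * M) * |y - target κ p|)
    (by unfold Function.uncurry; fun_prop) (hmoment.lintegral_exp_abs_centered_le hM hc)
  -- The threshold is 2M times the exponential budget 2c m² + L, with L absorbed by m².
  refine le_trans (measure_mono fun z hz => ?_) (measure_ge_le_of_lintegral_exp_le (by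
    fun_prop) h L)
  simp only [Set.mem_ofPred_eq, noise] at hz ⊢
  rw [← Finset.mul_sum, one_div, ← div_eq_inv_mul, le_div_iff₀ (by positivity)]
  nlinarith

/-- Concentration of the pairing of the centered outputs with a bounded function. -/
theorem MomentHypothesis.measure_sum_noise_mul_ge_le (hmoment : MomentHypothesis κ c M)
    (hM : 1 ≤ M) (hc : 0 < c) (hm : 0 < m) {f : X × X → ℝ} (hf : Measurable f) {K : ℝ} (hK : 0 < K)
    (hfK : ∀ p, |f p| ≤ K) {D E : ℝ} (hD : 1 ≤ D) (hE0 : 0 < E) (hE : E ≤ D * m ^ 2) :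
    sampleLaw ρX κ m {z | (2 * Real.exp (c / 2) * (1 + c) + 1) * (4 * M * K) * √D * (m * √E)
        ≤ ∑ ij : Fin m × Fin m, noise κ z ij * f (z.1 ij.1, z.1 ij.2)}
      ≤ ENNReal.ofReal (Real.exp (-E)) := by
  have hM0 : 0 < M := by linarith
  have hm0 : (0 : ℝ) < m := by exact_mod_cast hm
  have ht := measurable_target (κ := κ)
  have hD0 : 0 < D := by linarith
  -- The Chernoff parameter balances m²θ² against E up to constants. The factor √D, with E ≤ D m²,
  -- keeps θK ≤ 1/(4M), where the subgaussian bound is valid.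
  set θ := √E / (4 * M * K * √D * m) with hθ
  have hsE : 0 < √E := Real.sqrt_pos.2 hE0
  have hsD : 0 < √D := Real.sqrt_pos.2 hD0
  have hθ0 : 0 < θ := by positivity
  have hEDm : √E ≤ √D * m := by
    rw [← Real.sqrt_sq hm0.le, ← Real.sqrt_mul hD0.le]
    exact Real.sqrt_le_sqrt hE
  have hθK : θ * K ≤ 1 / (4 * M) := by
    have : θ * K = √E / (√D * m) * (1 / (4 * M)) := by rw [hθ]; field_simp
    rw [this]
    exact mul_le_of_le_one_left (by positivity) ((div_le_one (by positivity)).2 hEDm)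
  have h := lintegral_exp_sum_le (ρX := ρX) (κ := κ) (m := m)
    (φ := fun p y => θ * f p * (y - target κ p))
    (b := 32 * M ^ 2 * Real.exp (c / 2) * (1 + c) * (θ * K) ^ 2)
    (by unfold Function.uncurry; fun_prop) (fun p => by
      have h1 : |θ * f p| ≤ θ * K := by
        rw [abs_mul, abs_of_pos hθ0]
        exact mul_le_mul_of_nonneg_left (hfK p) hθ0.le
      refine (hmoment.lintegral_exp_centered_le hM hc p (h1.trans hθK)).trans ?_
      refine ENNReal.ofReal_le_ofReal (Real.exp_le_exp.2 ?_)
      refine mul_le_mul_of_nonneg_left ?_ (by positivity)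
      rw [← sq_abs]
      gcongr)
  refine le_trans (measure_mono fun z hz => ?_) (measure_ge_le_of_lintegral_exp_le (by
    fun_prop) h E)
  simp only [Set.mem_ofPred_eq, noise] at hz ⊢
  have h2 : ∑ ij : Fin m × Fin m, θ * f (z.1 ij.1, z.1 ij.2)
        * (z.2 ij - target κ (z.1 ij.1, z.1 ij.2))
      = θ * ∑ ij : Fin m × Fin m, (z.2 ij - target κ (z.1 ij.1, z.1 ij.2))
        * f (z.1 ij.1, z.1 ij.2) := by
    rw [Finset.mul_sum]
    exact Finset.sum_congr rfl fun ij _ => by ring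
  rw [h2]
  refine le_trans ?_ (mul_le_mul_of_nonneg_left hz hθ0.le)
  have h3 : θ * ((2 * Real.exp (c / 2) * (1 + c) + 1) * (4 * M * K) * √D * (m * √E))
      = (2 * Real.exp (c / 2) * (1 + c) + 1) * E := by
    rw [hθ]
    field_simp
    rw [Real.sq_sqrt hE0.le]
  rw [h3]
  have h4 : (m : ℝ) ^ 2 * (32 * M ^ 2 * Real.exp (c / 2) * (1 + c) * (θ * K) ^ 2)
      = 2 * Real.exp (c / 2) * (1 + c) * E / D := by
    rw [hθ]
    field_simp
    rw [Real.sq_sqrt hE0.le, Real.sq_sqrt hD0.le]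
    ring
  rw [h4]
  have h5 : 2 * Real.exp (c / 2) * (1 + c) * E / D ≤ 2 * Real.exp (c / 2) * (1 + c) * E :=
    div_le_self (by positivity) hD
  linarith

/-- The excess risk is the squared distance to the target. -/
theorem MomentHypothesis.risk_sub_risk_target (hmoment : MomentHypothesis κ c M)
    (hM : 1 ≤ M) (hc : 0 < c) {f : X × X → ℝ} (hf : Measurable f) {K : ℝ}
    (hfK : ∀ p, |f p| ≤ K) :
    risk ρX κ f - risk ρX κ (target κ) = ∫ p, (target κ p - f p) ^ 2 ∂(ρX.prod ρX) := by
  have ht := measurable_target (κ := κ)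
  have htb := hmoment.abs_target_le hM hc
  have hsq (p : X × X) : Integrable (fun y => y ^ 2) (κ p) := by
    simpa using hmoment.integrable_abs_pow (ℓ := 2) (by norm_num) p
  have hid := hmoment.integrable_id
  have hint (g : X × X → ℝ) (hg : Measurable g) (B : ℝ) (hB : ∀ p, |g p| ≤ B) :
      Integrable (fun z : (X × X) × ℝ => (z.2 - g z.1) ^ 2) (jointLaw ρX κ) := by
    refine ⟨by fun_prop, ?_⟩
    rw [hasFiniteIntegral_iff_ofReal (ae_of_all _ fun z => sq_nonneg _), jointLaw,
      Measure.lintegral_compProd (by fun_prop)]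
    calc _ ≤ ∫⁻ _ : X × X, (2 * ENNReal.ofReal (c * 2 * M ^ 2) + ENNReal.ofReal (2 * B ^ 2))
          ∂(ρX.prod ρX) := by
          refine lintegral_mono fun p => ?_
          calc _ ≤ ∫⁻ y, (2 * ENNReal.ofReal (|y| ^ 2) + ENNReal.ofReal (2 * B ^ 2)) ∂(κ p) := by
                refine lintegral_mono fun y => ?_
                rw [show (2 : ℝ≥0∞) = ENNReal.ofReal 2 by simp, ← ENNReal.ofReal_mul (by norm_num),
                  ← ENNReal.ofReal_add (by positivity) (by positivity)]
                refine ENNReal.ofReal_le_ofReal ?_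
                have : g p ^ 2 ≤ B ^ 2 := by
                  rw [← sq_abs]
                  exact pow_le_pow_left₀ (abs_nonneg _) (hB p) 2
                simp only [sq_abs]
                nlinarith [sq_nonneg (y + g p)]
            _ ≤ _ := by
                rw [lintegral_add_right _ measurable_const, lintegral_const_mul _ (by fun_prop)]
                have := hmoment 2 (by norm_num) p
                simp only [Nat.factorial] at this
                simp only [lintegral_const, measure_univ, mul_one]
                gcongr
                simpa using this
      _ < ⊤ := by
          simp only [lintegral_const, measure_univ, mul_one]
          exact ENNReal.add_lt_top.2
            ⟨ENNReal.mul_lt_top (by simp) ENNReal.ofReal_lt_top, ENNReal.ofReal_lt_top⟩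
  rw [risk, risk, ← integral_sub (hint f hf K hfK) (hint _ ht _ htb)]
  have h := Measure.integral_compProd ((hint f hf K hfK).sub (hint _ ht _ htb))
  rw [← jointLaw] at h
  refine h.trans (integral_congr_ae (ae_of_all _ fun p => ?_))
  -- The y² terms cancel: the difference is affine in y, so its fibre integral sees only the
  -- conditional mean.
  have h1 (y : ℝ) : ((fun z : (X × X) × ℝ => (z.2 - f z.1) ^ 2)
      - fun z : (X × X) × ℝ => (z.2 - target κ z.1) ^ 2) (p, y)
      = 2 * (target κ p - f p) * y + (f p ^ 2 - target κ p ^ 2) := by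
    simp only [Pi.sub_apply]; ring
  simp only [h1]
  rw [integral_add ((hid p).const_mul _) (integrable_const _), integral_const_mul]
  simp only [integral_const, probReal_univ, smul_eq_mul, one_mul]
  rw [show ∫ y, y ∂(κ p) = target κ p from rfl]
  ring

end Sample

/-! ### Clipping, union bound, and the clipped loss -/

section Projection

variable {B : ℝ}

theorem proj_eq_max_min (hB : 0 ≤ B) (t : ℝ) : proj B t = max (-B) (min B t) := by
  unfold proj
  split_ifs with h1 h2
  · rw [min_eq_left h1.le, max_eq_right (by linarith)]
  · rw [min_eq_right (by linarith), max_eq_left h2.le]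
  · rw [min_eq_right (by linarith), max_eq_right (by linarith)]

theorem abs_proj_le (hB : 0 ≤ B) (t : ℝ) : |proj B t| ≤ B := by
  rw [proj_eq_max_min hB, abs_le]
  exact ⟨le_max_left _ _, max_le (by linarith) (min_le_left _ _)⟩

theorem proj_of_abs_le {t : ℝ} (h : |t| ≤ B) : proj B t = t := by
  rw [abs_le] at h
  rw [proj, if_neg (by linarith), if_neg (by linarith)]

theorem abs_proj_sub_proj_le (hB : 0 ≤ B) (a b : ℝ) : |proj B a - proj B b| ≤ |a - b| := by
  rw [proj_eq_max_min hB, proj_eq_max_min hB]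
  refine (abs_max_sub_max_le_max _ _ _ _).trans (max_le (by simp) ?_)
  exact (abs_min_sub_min_le_max _ _ _ _).trans (max_le (by simp) le_rfl)

theorem measurable_proj (hB : 0 ≤ B) : Measurable (proj B) := by
  rw [funext (proj_eq_max_min hB)]
  fun_prop

end Projection

section UnionBound

/-- A finite union of events, each of probability at most `exp (-(b + L))`, with `log` of the
number of events at most `b`. -/
theorem measure_biUnion_le_exp {Ω ι : Type*} [MeasurableSpace Ω] (μ : Measure Ω) (N : Finset ι)
    (hN : 0 < N.card) (S : ι → Set Ω) {b L : ℝ} (hb : Real.log N.card ≤ b)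
    (h : ∀ i ∈ N, μ (S i) ≤ ENNReal.ofReal (Real.exp (-(b + L)))) :
    μ (⋃ i ∈ N, S i) ≤ ENNReal.ofReal (Real.exp (-L)) := by
  refine (measure_biUnion_finset_le N S).trans ((Finset.sum_le_sum h).trans ?_)
  rw [Finset.sum_const, nsmul_eq_mul, ← ENNReal.ofReal_natCast,
    ← ENNReal.ofReal_mul (Nat.cast_nonneg _)]
  refine ENNReal.ofReal_le_ofReal ?_
  have hc : (0 : ℝ) < N.card := by exact_mod_cast hN
  calc (N.card : ℝ) * Real.exp (-(b + L)) ≤ Real.exp b * Real.exp (-(b + L)) := by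
        gcongr
        rwa [← Real.log_le_iff_le_exp hc]
    _ = Real.exp (-L) := by rw [← Real.exp_add]; ring_nf

end UnionBound

section ProjLoss

variable {X : Type u}

theorem pairAverage_le_pairAverage_add {m : ℕ} (hm : 2 ≤ m) {f g : X × X → ℝ} {a : ℝ}
    (h : ∀ p, f p ≤ g p + a) (x : Fin m → X) : pairAverage f x ≤ pairAverage g x + a := by
  have hm2 : (2 : ℝ) ≤ m := by exact_mod_cast hm
  have hmm : 0 < (m * (m - 1) : ℝ) := mul_pos (by linarith) (by linarith)
  have hcard : ((Finset.univ : Finset (Fin m)).offDiag.card : ℝ) = m * (m - 1) := by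
    rw [Finset.offDiag_card, Finset.card_univ, Fintype.card_fin, Nat.cast_sub (Nat.le_mul_self m)]
    push_cast; ring
  have h1 : ∑ p ∈ (Finset.univ : Finset (Fin m)).offDiag, f (x p.1, x p.2)
      ≤ ∑ p ∈ (Finset.univ : Finset (Fin m)).offDiag, g (x p.1, x p.2) + m * (m - 1) * a := by
    refine (Finset.sum_le_sum fun p _ => h (x p.1, x p.2)).trans (le_of_eq ?_)
    rw [Finset.sum_add_distrib, Finset.sum_const, nsmul_eq_mul, hcard]
  unfold pairAverage
  rw [one_div, inv_mul_le_iff₀ hmm, mul_add, mul_inv_cancel_left₀ hmm.ne']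
  exact h1

variable [MeasurableSpace X] {κ : Kernel (X × X) ℝ}

/-- The squared distance between the projections of the target and of `f`. -/
noncomputable def projLoss (κ : Kernel (X × X) ℝ) (B : ℝ) (f : X × X → ℝ) (p : X × X) : ℝ :=
  (proj B (target κ p) - proj B (f p)) ^ 2

theorem projLoss_nonneg {B : ℝ} (f : X × X → ℝ) (p : X × X) : 0 ≤ projLoss κ B f p :=
  sq_nonneg _

theorem projLoss_le {B : ℝ} (hB : 0 ≤ B) (f : X × X → ℝ) (p : X × X) :
    projLoss κ B f p ≤ 4 * B ^ 2 := by
  have h1 := abs_le.1 (abs_proj_le hB (target κ p))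
  have h2 := abs_le.1 (abs_proj_le hB (f p))
  unfold projLoss
  nlinarith

/-- Clipping the target together with `f` makes this hold at every pair. Against the unclipped
target it could fail where the target exceeds `B`, possibly on a null set, such as the diagonal,
that the sample visits. -/
theorem projLoss_le_sq {B : ℝ} (hB : 0 ≤ B) (f : X × X → ℝ) (p : X × X) :
    projLoss κ B f p ≤ (target κ p - f p) ^ 2 :=
  sq_le_sq.2 (abs_proj_sub_proj_le hB _ _)

theorem measurable_projLoss {B : ℝ} (hB : 0 ≤ B) {f : X × X → ℝ} (hf : Measurable f) :
    Measurable (projLoss κ B f) := by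
  have := measurable_target (κ := κ)
  have := measurable_proj hB
  unfold projLoss
  fun_prop

/-- A difference of squares: one factor is at most η by contraction, the other at most 4B by
clipping. -/
theorem projLoss_le_add {B η : ℝ} (hB : 0 ≤ B) {f g : X × X → ℝ} {p : X × X}
    (h : |f p - g p| ≤ η) : projLoss κ B f p ≤ projLoss κ B g p + 4 * B * η := by
  have h1 := abs_le.1 (abs_proj_le hB (target κ p))
  have h2 := abs_le.1 (abs_proj_le hB (f p))
  have h3 := abs_le.1 (abs_proj_le hB (g p))
  have h4 := (abs_proj_sub_proj_le hB (f p) (g p)).trans h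
  unfold projLoss
  have h5 : |2 * proj B (target κ p) - proj B (f p) - proj B (g p)| ≤ 4 * B :=
    abs_le.2 ⟨by linarith, by linarith⟩
  have h6 : |(proj B (f p) - proj B (g p))
      * (2 * proj B (target κ p) - proj B (f p) - proj B (g p))| ≤ η * (4 * B) := by
    rw [abs_mul]
    exact mul_le_mul h4 h5 (abs_nonneg _) ((abs_nonneg _).trans h)
  linarith [(abs_le.1 h6).1]

theorem integrable_projLoss {ρX : Measure X} [IsProbabilityMeasure ρX] {B : ℝ}
    (hB : 0 ≤ B) {f : X × X → ℝ} (hf : Measurable f) :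
    Integrable (projLoss κ B f) (ρX.prod ρX) :=
  Integrable.of_bound (measurable_projLoss hB hf).aestronglyMeasurable (4 * B ^ 2)
    (ae_of_all _ fun p => by
      rw [Real.norm_of_nonneg (projLoss_nonneg f p)]; exact projLoss_le hB f p)

end ProjLoss

/-! ### Uniform bounds through covering numbers -/

section Uniform

variable {X : Type u} [MetricSpace X] [CompactSpace X] [MeasurableSpace X] [BorelSpace X]
  {H : Type v} [NormedAddCommGroup H] [InnerProductSpace ℝ H] [RKHS ℝ H (X × X) ℝ]
  {ρX : Measure X} [IsProbabilityMeasure ρX] {κ : Kernel (X × X) ℝ} [IsMarkovKernel κ]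
  {s Cs c M K : ℝ}

/-- Uniform control over the whole space of the pairing with the centered outputs. -/
theorem MomentHypothesis.exists_measure_sum_noise_le (hmoment : MomentHypothesis κ c M)
    (hM : 1 ≤ M) (hc : 0 < c) (hcap : CapacityCondition (X := X) H s Cs)
    (hcont : ∀ k : H, Continuous fun p => k p) (hK : 1 ≤ K)
    (hKb : ∀ (k : H) p, |k p| ≤ K * ‖k‖) {D : ℝ} (hD : 1 ≤ D) (hCs : 0 < Cs) :
    ∃ Γ : ℝ, 0 < Γ ∧ ∀ m : ℕ, 0 < m → ∀ η L : ℝ, 0 < η → 0 ≤ L → L ≤ (m : ℝ) ^ 2 →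
      Cs * (1 / η) ^ s + 1 + L ≤ D * m ^ 2 →
      sampleLaw ρX κ m {z | ¬ ∀ k : H, |∑ ij, noise κ z ij * k (z.1 ij.1, z.1 ij.2)|
        ≤ Γ * (m * √(Cs * (1 / η) ^ s + 1 + L) + η * m ^ 2) * ‖k‖}
      ≤ 2 * ENNReal.ofReal (Real.exp (-L)) := by
  set Γ₁ := (2 * Real.exp (c / 2) * (1 + c) + 1) * (4 * M * K) * √D with hΓ₁
  set Γ₂ := 2 * M * (2 * c + 1) with hΓ₂
  have hΓ₁0 : 0 ≤ Γ₁ := by positivity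
  have hΓ₂0 : 0 < Γ₂ := by positivity
  refine ⟨Γ₁ + Γ₂, by positivity, fun m hm η L hη hL hLm2 hE => ?_⟩
  obtain ⟨N, hN0, hNlog, hN⟩ := hcap.exists_net hcont hη
  set E := Cs * (1 / η) ^ s + 1 + L with hEdef
  have hηs : 0 ≤ Cs * (1 / η) ^ s := by positivity
  have hm0 : (0 : ℝ) < m := by exact_mod_cast hm
  have hK0 : 0 < K := by linarith
  -- Net centers may exceed `K`. Clipping them restores the bound needed for concentration and keeps
  -- them close to unit-ball elements, which are bounded by `K` themselves.
  let w (f : C(X × X, ℝ)) (p : X × X) : ℝ := proj K (f p)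
  have hw (f) : Measurable (w f) := (measurable_proj hK0.le).comp f.continuous.measurable
  let S (f : C(X × X, ℝ)) : Set ((Fin m → X) × (Fin m × Fin m → ℝ)) :=
    {z | Γ₁ * (m * √E) ≤ |∑ ij, noise κ z ij * w f (z.1 ij.1, z.1 ij.2)|}
  have hS (f) : sampleLaw ρX κ m (S f)
      ≤ ENNReal.ofReal (Real.exp (-(Cs * (1 / η) ^ s + L))) := by
    have h1 := hmoment.measure_sum_noise_mul_ge_le (ρX := ρX) hM hc hm (hw f) hK0
      (fun p => abs_proj_le hK0.le _) hD (by linarith : 0 < E) hE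
    have h2 := hmoment.measure_sum_noise_mul_ge_le (ρX := ρX) hM hc hm (hw f).neg hK0
      (fun p => by rw [Pi.neg_apply, abs_neg]; exact abs_proj_le hK0.le _) hD
      (by linarith : 0 < E) hE
    refine (measure_mono ?_).trans ((measure_union_le _ _).trans ((add_le_add h1 h2).trans ?_))
    · intro z hz
      have hz' : Γ₁ * (m * √E) ≤ |∑ ij, noise κ z ij * w f (z.1 ij.1, z.1 ij.2)| := hz
      rcases le_abs.1 hz' with h | h
      · exact Or.inl h
      · refine Or.inr ?_
        simpa only [Set.mem_ofPred_eq, Pi.neg_apply, mul_neg, Finset.sum_neg_distrib] using h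
    · rw [← ENNReal.ofReal_add (Real.exp_pos _).le (Real.exp_pos _).le]
      refine ENNReal.ofReal_le_ofReal ?_
      -- The summand 1 in `E` pays for the two signs, since 2 ≤ e.
      have h3 : Real.exp (-(Cs * (1 / η) ^ s + L)) = Real.exp 1 * Real.exp (-E) := by
        rw [← Real.exp_add, hEdef]; ring_nf
      rw [h3]
      nlinarith [Real.exp_pos (-E), Real.add_one_le_exp 1]
  have hLm : sampleLaw ρX κ m {z | Γ₂ * m ^ 2 ≤ ∑ ij, |noise κ z ij|}
      ≤ ENNReal.ofReal (Real.exp (-L)) :=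
    hmoment.measure_sum_abs_noise_ge_le hM hc hLm2
  have hunion := measure_biUnion_le_exp (sampleLaw ρX κ m) N hN0 S hNlog fun f _ => hS f
  rw [two_mul]
  refine (measure_mono ?_).trans ((measure_union_le _ _).trans (add_le_add hLm hunion))
  intro z hz
  by_contra hnot
  simp only [Set.mem_union, Set.mem_iUnion, not_or, not_exists, Set.mem_ofPred_eq, not_le, S]
    at hnot
  obtain ⟨ha, hb⟩ := hnot
  refine hz fun k => ?_
  by_cases hk : ‖k‖ = 0
  · have : k = 0 := norm_eq_zero.1 hk
    simp [this]
  have hk0 : 0 < ‖k‖ := lt_of_le_of_ne (norm_nonneg k) (Ne.symm hk)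
  -- The pairing is homogeneous in `k`, so one net of the unit ball serves the whole space.
  obtain ⟨f, hf, hfk⟩ := hN (‖k‖⁻¹ • k) (by rw [norm_smul]; simp [hk])
  have hclose (p : X × X) : |k p - ‖k‖ * w f p| ≤ ‖k‖ * η := by
    have h1 : k p = ‖k‖ * (‖k‖⁻¹ • k) p := by
      rw [RKHS.coe_smul, Pi.smul_apply, smul_eq_mul, mul_inv_cancel_left₀ hk]
    have h2 : |(‖k‖⁻¹ • k) p| ≤ K := by
      refine (hKb _ p).trans ?_
      rw [norm_smul]; simp [hk]
    rw [h1, ← mul_sub, abs_mul, abs_norm]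
    refine mul_le_mul_of_nonneg_left ?_ hk0.le
    rw [← proj_of_abs_le h2]
    exact (abs_proj_sub_proj_le hK0.le _ _).trans (hfk p)
  have hsplit : ∑ ij, noise κ z ij * k (z.1 ij.1, z.1 ij.2)
      = ‖k‖ * ∑ ij, noise κ z ij * w f (z.1 ij.1, z.1 ij.2)
        + ∑ ij, noise κ z ij * (k (z.1 ij.1, z.1 ij.2) - ‖k‖ * w f (z.1 ij.1, z.1 ij.2)) := by
    rw [Finset.mul_sum, ← Finset.sum_add_distrib]
    exact Finset.sum_congr rfl fun ij _ => by ring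
  rw [hsplit]
  have hfirst := (hb f hf).le
  have hsecond : |∑ ij, noise κ z ij
        * (k (z.1 ij.1, z.1 ij.2) - ‖k‖ * w f (z.1 ij.1, z.1 ij.2))|
      ≤ (Γ₂ * m ^ 2) * (‖k‖ * η) := by
    refine (Finset.abs_sum_le_sum_abs _ _).trans ?_
    grw [← ha]
    rw [Finset.sum_mul]
    refine Finset.sum_le_sum fun ij _ => ?_
    rw [abs_mul]
    exact mul_le_mul_of_nonneg_left (hclose _) (abs_nonneg _)
  refine (abs_add_le _ _).trans ?_
  rw [abs_mul, abs_norm]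
  have h5 := mul_le_mul_of_nonneg_left hfirst hk0.le
  have h6 : 0 ≤ Γ₂ * (m * √E) * ‖k‖ := by positivity
  have h7 : 0 ≤ Γ₁ * (η * m ^ 2) * ‖k‖ := by positivity
  nlinarith

/-- Uniform lower deviation of the empirical projected loss over a ball. -/
theorem measure_integral_projLoss_le (hcap : CapacityCondition (X := X) H s Cs)
    (hcont : ∀ k : H, Continuous fun p => k p) (hCs : 0 < Cs) {m : ℕ} (hm : 2 ≤ m)
    {B R η L : ℝ} (hB : 0 < B) (hR : 0 < R) (hη : 0 < η) (hL : 0 ≤ L) :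
    sampleLaw ρX κ m {z | ¬ ∀ k : H, ‖k‖ ≤ R → ∫ p, projLoss κ B k p ∂(ρX.prod ρX)
        ≤ 2 * pairAverage (projLoss κ B k) z.1 + 24 * B ^ 2 * (Cs * (R / η) ^ s + L) / m
          + 12 * B * η}
      ≤ ENNReal.ofReal (Real.exp (-L)) := by
  obtain ⟨N, hN0, hNlog, hN⟩ := hcap.exists_net hcont (div_pos hη hR)
  rw [one_div_div] at hNlog
  let G (f : C(X × X, ℝ)) : X × X → ℝ := projLoss κ B fun p => R * f p
  have hmf (f : C(X × X, ℝ)) : Measurable fun p => R * f p :=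
    f.continuous.measurable.const_mul R
  have hG (f) : Measurable (G f) := measurable_projLoss hB.le (hmf f)
  let S (f : C(X × X, ℝ)) : Set (Fin m → X) :=
    {x | 2 * pairAverage (G f) x + 6 * (4 * B ^ 2) * (Cs * (R / η) ^ s + L) / m
      ≤ ∫ p, G f p ∂(ρX.prod ρX)}
  have hSm (f) : MeasurableSet (S f) := by
    have := measurable_pairAverage (m := m) (hG f)
    exact measurableSet_le (by fun_prop) measurable_const
  have hS (f) : sampleLaw ρX κ m {z | z.1 ∈ S f}
      ≤ ENNReal.ofReal (Real.exp (-(Cs * (R / η) ^ s + L))) := by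
    rw [sampleLaw_preimage_fst (hSm f)]
    exact measure_pairAverage_le_le ρX hm (hG f) (by positivity) (fun p => sq_nonneg _)
      (projLoss_le hB.le _) (by positivity)
  refine (measure_mono ?_).trans (measure_biUnion_le_exp (sampleLaw ρX κ m) N hN0
    (fun f => {z | z.1 ∈ S f}) hNlog fun f _ => hS f)
  intro z hz
  by_contra hnot
  simp only [Set.mem_iUnion, not_exists, Set.mem_ofPred_eq, not_le, S] at hnot
  refine hz fun k hk => ?_
  obtain ⟨f, hf, hfk⟩ := hN (R⁻¹ • k) (by
    rw [norm_smul, Real.norm_of_nonneg (by positivity), inv_mul_le_iff₀ hR, mul_one]; exact hk)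
  have hclose (p : X × X) : |k p - R * f p| ≤ η := by
    have h1 : k p = R * (R⁻¹ • k) p := by
      rw [RKHS.coe_smul, Pi.smul_apply, smul_eq_mul, mul_inv_cancel_left₀ hR.ne']
    rw [h1, ← mul_sub, abs_mul, abs_of_pos hR]
    calc R * _ ≤ R * (η / R) := mul_le_mul_of_nonneg_left (hfk p) hR.le
      _ = η := by field_simp
  have h1 : ∫ p, projLoss κ B k p ∂(ρX.prod ρX) ≤ ∫ p, G f p ∂(ρX.prod ρX) + 4 * B * η := by
    have h2 : ∫ p, (G f p + 4 * B * η) ∂(ρX.prod ρX)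
        = ∫ p, G f p ∂(ρX.prod ρX) + 4 * B * η := by
      rw [integral_add (integrable_projLoss hB.le (hmf f)) (integrable_const _)]
      simp [G]
    rw [← h2]
    exact integral_mono (integrable_projLoss hB.le (hcont k).measurable)
      ((integrable_projLoss hB.le (hmf f)).add (integrable_const _))
      fun p => projLoss_le_add hB.le (hclose p)
  -- Passing to the net costs 4Bη in the integral and, after the factor 2, 8Bη in the empirical
  -- average, whence 12Bη.
  have h3 : pairAverage (G f) z.1 ≤ pairAverage (projLoss κ B k) z.1 + 4 * B * η :=
    pairAverage_le_pairAverage_add hm (fun p => projLoss_le_add hB.le (by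
      rw [abs_sub_comm]; exact hclose p)) z.1
  have h4 := hnot f hf
  have h5 : 6 * (4 * B ^ 2) * (Cs * (R / η) ^ s + L) / m
    = 24 * B ^ 2 * (Cs * (R / η) ^ s + L) / m := by ring
  linarith

end Uniform

/-! ### Empirical averages and the basic inequality -/

section Empirical

variable {X : Type u} {m : ℕ}

theorem sum_pairs_eq (h : X × X → ℝ) (x : Fin m → X) (hm : 2 ≤ m) :
    ∑ ij : Fin m × Fin m, h (x ij.1, x ij.2)
      = ∑ i, h (x i, x i) + m * (m - 1) * pairAverage h x := by
  have hm2 : (2 : ℝ) ≤ m := by exact_mod_cast hm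
  have hmm : (m * (m - 1) : ℝ) ≠ 0 := mul_ne_zero (by linarith) (by linarith)
  rw [pairAverage, ← mul_assoc, mul_one_div_cancel hmm, one_mul, ← Finset.univ_product_univ,
    ← Finset.diag_union_offDiag, Finset.sum_union (Finset.disjoint_diag_offDiag _),
    Finset.sum_diag]

theorem pairAverage_nonneg (hm : 2 ≤ m) {h : X × X → ℝ} (h0 : ∀ p, 0 ≤ h p) (x : Fin m → X) :
    0 ≤ pairAverage h x := by
  have hm2 : (2 : ℝ) ≤ m := by exact_mod_cast hm
  have : 0 ≤ (m * (m - 1) : ℝ) := mul_nonneg (by linarith) (by linarith)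
  exact mul_nonneg (by positivity) (Finset.sum_nonneg fun p _ => h0 _)

/-- The nonnegative diagonal is dropped, and m² ≤ 2m(m - 1) for m ≥ 2. -/
theorem pairAverage_le_two_mul_sum (hm : 2 ≤ m) {h : X × X → ℝ} (h0 : ∀ p, 0 ≤ h p)
    (x : Fin m → X) :
    pairAverage h x ≤ 2 * (1 / (m : ℝ) ^ 2 * ∑ ij : Fin m × Fin m, h (x ij.1, x ij.2)) := by
  have hm2 : (2 : ℝ) ≤ m := by exact_mod_cast hm
  have h1 : 0 ≤ ∑ i, h (x i, x i) := Finset.sum_nonneg fun i _ => h0 _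
  have h2 := pairAverage_nonneg hm h0 x
  rw [sum_pairs_eq h x hm, one_div, ← mul_assoc, mul_comm 2, mul_assoc,
    le_inv_mul_iff₀ (by positivity)]
  have h3 : (0 : ℝ) ≤ m * (m - 2) := mul_nonneg (by linarith) (by linarith)
  nlinarith [mul_nonneg h3 h2]

/-- The diagonal has only m of the m² terms, so a bound valid at every pair makes it cost B/m. -/
theorem sum_le_pairAverage_add (hm : 2 ≤ m) {h : X × X → ℝ} (h0 : ∀ p, 0 ≤ h p) {B : ℝ}
    (hB : ∀ p, h p ≤ B) (x : Fin m → X) :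
    1 / (m : ℝ) ^ 2 * ∑ ij : Fin m × Fin m, h (x ij.1, x ij.2) ≤ B / m + pairAverage h x := by
  have hm2 : (2 : ℝ) ≤ m := by exact_mod_cast hm
  have h1 : ∑ i, h (x i, x i) ≤ m * B := by
    refine (Finset.sum_le_sum fun i _ => hB (x i, x i)).trans (le_of_eq ?_)
    simp
  have h2 := pairAverage_nonneg hm h0 x
  rw [sum_pairs_eq h x hm, one_div, inv_mul_le_iff₀ (by positivity)]
  have h3 : (m : ℝ) ^ 2 * (B / m + pairAverage h x) = m * B + m ^ 2 * pairAverage h x := by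
    field_simp
  rw [h3]
  nlinarith [mul_nonneg (by linarith : (0 : ℝ) ≤ m) h2]

variable [MeasurableSpace X] {H : Type v} [NormedAddCommGroup H] [InnerProductSpace ℝ H]
  [RKHS ℝ H (X × X) ℝ] {κ : Kernel (X × X) ℝ}

/-- The basic inequality for regularized least squares against a comparator `l`. -/
theorem IsRegLSSolution.basic_inequality (hm : 0 < m) {lam A : ℝ} (hlam : 0 < lam)
    {z : (Fin m → X) × (Fin m × Fin m → ℝ)} {k : H} (hk : IsRegLSSolution lam z k) (l : H)
    (hA0 : 0 ≤ A)
    (hA : ∀ k' : H, |∑ ij, noise κ z ij * k' (z.1 ij.1, z.1 ij.2)| ≤ A * m ^ 2 * ‖k'‖) :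
    1 / (m : ℝ) ^ 2 * ∑ ij : Fin m × Fin m,
        (target κ (z.1 ij.1, z.1 ij.2) - k (z.1 ij.1, z.1 ij.2)) ^ 2 + lam * ‖k‖ ^ 2 / 2
      ≤ 1 / (m : ℝ) ^ 2 * ∑ ij : Fin m × Fin m,
        (target κ (z.1 ij.1, z.1 ij.2) - l (z.1 ij.1, z.1 ij.2)) ^ 2 + 2 * (lam * ‖l‖ ^ 2)
        + 3 * (A ^ 2 / lam) := by
  have hm0 : (0 : ℝ) < m := by exact_mod_cast hm
  have hkl := hk l
  have hrisk (f : H) : regEmpiricalRisk lam z f = 1 / (m : ℝ) ^ 2 * ∑ ij : Fin m × Fin m,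
      (z.2 ij - f (z.1 ij.1, z.1 ij.2)) ^ 2 + lam * ‖f‖ ^ 2 := by
    rw [regEmpiricalRisk, Fintype.sum_prod_type]
  rw [hrisk, hrisk] at hkl
  have hexp : ∑ ij : Fin m × Fin m, (z.2 ij - k (z.1 ij.1, z.1 ij.2)) ^ 2
      = ∑ ij : Fin m × Fin m, (z.2 ij - l (z.1 ij.1, z.1 ij.2)) ^ 2
        + ∑ ij : Fin m × Fin m, (target κ (z.1 ij.1, z.1 ij.2) - k (z.1 ij.1, z.1 ij.2)) ^ 2
        - ∑ ij : Fin m × Fin m, (target κ (z.1 ij.1, z.1 ij.2) - l (z.1 ij.1, z.1 ij.2)) ^ 2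
        + 2 * ∑ ij, noise κ z ij * (l - k) (z.1 ij.1, z.1 ij.2) := by
    simp only [Finset.mul_sum, ← Finset.sum_add_distrib, ← Finset.sum_sub_distrib]
    refine Finset.sum_congr rfl fun ij _ => ?_
    rw [RKHS.coe_sub, Pi.sub_apply, noise]
    ring
  rw [hexp] at hkl
  have hN : -(A * ‖l - k‖) ≤ 1 / (m : ℝ) ^ 2 *
      ∑ ij, noise κ z ij * (l - k) (z.1 ij.1, z.1 ij.2) := by
    rw [one_div, le_inv_mul_iff₀ (by positivity)]
    linarith [(abs_le.1 (hA (l - k))).1]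
  have hnorm := mul_le_mul_of_nonneg_left (norm_sub_le l k) hA0
  have hyoung (a w : ℝ) (hw : 0 < w) : 2 * (A * a) ≤ w * a ^ 2 + A ^ 2 / w := by
    rw [← sub_nonneg]
    have : w * a ^ 2 + A ^ 2 / w - 2 * (A * a) = (w * a - A) ^ 2 / w := by field_simp; ring
    rw [this]; positivity
  -- Weight lam/2 leaves half of lam‖k‖² on the left and costs 2A²/lam; weight lam for `l` adds the
  -- third A²/lam.
  have h1 := hyoung ‖k‖ (lam / 2) (by positivity)
  have h2 := hyoung ‖l‖ lam hlam
  have h3 : A ^ 2 / (lam / 2) = 2 * (A ^ 2 / lam) := by field_simp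
  rw [h3] at h1
  simp only [mul_add, mul_sub] at hkl
  linarith

end Empirical

/-! ### Arithmetic of the exponents -/

section Exponents

/-- Powers of a number at least one, compared through their exponents. -/
theorem rpow_mul_rpow_le {x a b d : ℝ} (hx : 1 ≤ x) (h : a + b ≤ d) : x ^ a * x ^ b ≤ x ^ d := by
  rw [← Real.rpow_add (by linarith)]
  exact Real.rpow_le_rpow_of_exponent_le hx h

/-- The relations between the exponents that govern the learning rate. -/
theorem rate_exponents {α s b : ℝ} (hs : 0 < s) (hα0 : 0 < α) (hα1 : α ≤ 1)
    (hα : α < (1 + s) / (s * (2 + s))) (hb : b = 1 / (2 + s) - α * s / (1 + s)) :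
    0 < b ∧ b ≤ 1 / 2 ∧ s * (α / 2 + b) - 1 ≤ -b ∧ (α + b) * (2 + s) ≤ 3 := by
  have hα' : α * (s * (2 + s)) < 1 + s := (lt_div_iff₀ (by positivity)).1 hα
  have hb' : b * ((2 + s) * (1 + s)) = 1 + s - α * s * (2 + s) := by rw [hb]; field_simp
  -- The upper bound on α is equivalent to positivity of b.
  have hb0 : 0 < b := by
    by_contra! h
    have : b * ((2 + s) * (1 + s)) ≤ 0 := mul_nonpos_of_nonpos_of_nonneg h (by positivity)
    linarith
  refine ⟨hb0, ?_, ?_, ?_⟩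
  · have h1 : b * (2 + s) = 1 - α * s / (1 + s) * (2 + s) := by rw [hb]; field_simp
    have h2 : 0 ≤ α * s / (1 + s) * (2 + s) := by positivity
    have h3 := mul_pos hb0 hs
    linarith
  · have h1 : b * (1 + s) + α * s = (1 + s) / (2 + s) := by
      rw [eq_div_iff (by positivity)]; linarith
    have h2 : (1 + s) / (2 + s) ≤ 1 := by rw [div_le_one (by positivity)]; linarith
    have h3 := mul_pos hα0 hs
    linarith
  · have h1 : b * (2 + s) = 1 - α * s * (2 + s) / (1 + s) := by rw [hb]; field_simp
    have h2 : (α + b) * (2 + s) = 1 + α * ((2 + s) / (1 + s)) := by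
      rw [add_mul, h1]; field_simp; ring
    have h3 : (2 + s) / (1 + s) ≤ 2 := by rw [div_le_iff₀ (by positivity)]; linarith
    have h4 := mul_le_mul hα1 h3 (by positivity) zero_le_one
    rw [h2]
    linarith

variable {x α b s Cs L : ℝ}

theorem one_div_rpow_neg_rpow (hx : 1 ≤ x) (a s : ℝ) : (1 / x ^ (-a)) ^ s = x ^ (a * s) := by
  have hx0 : 0 ≤ x := by linarith
  rw [one_div, ← Real.rpow_neg hx0, neg_neg, ← Real.rpow_mul hx0]

/-- Provides the condition E ≤ D m², with D = Cs + 2, under which the noise concentration applies.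
-/
theorem entropy_budget_le (hx : 1 ≤ x) (hαb : (α + b) * (2 + s) ≤ 3) (hαb0 : 0 ≤ α + b)
    (hCs : 0 < Cs) (hL : L ≤ x ^ 2) :
    Cs * (1 / x ^ (-((α + b) / 2))) ^ s + 1 + L ≤ (Cs + 2) * x ^ 2 := by
  have h1 : x ^ ((α + b) / 2 * s) ≤ x ^ 2 := by
    rw [← Real.rpow_natCast]
    refine Real.rpow_le_rpow_of_exponent_le hx ?_
    push_cast
    linarith
  have h2 : (1 : ℝ) ≤ x ^ 2 := one_le_pow₀ hx
  have h3 := mul_le_mul_of_nonneg_left h1 hCs.le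
  rw [one_div_rpow_neg_rpow hx]
  linarith

/-- The contribution of the noise at the balanced covering radius `x ^ (-(α + b) / 2)`. -/
theorem noise_level_sq_le (Γ : ℝ) (hx : 1 ≤ x) (hα1 : α ≤ 1) (hb : b ≤ 1 / 2)
    (hαb : (α + b) * (2 + s) ≤ 3) (hCs : 0 < Cs) (hL : 1 ≤ L) :
    (Γ * (√(Cs * (1 / x ^ (-((α + b) / 2))) ^ s + 1 + L) / x + x ^ (-((α + b) / 2)))) ^ 2 * x ^ α
      ≤ 2 * Γ ^ 2 * (Cs + 3) * (L * x ^ (-b)) := by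
  have hx0 : 0 < x := by linarith
  rw [one_div_rpow_neg_rpow hx]
  set η := x ^ (-((α + b) / 2))
  set E := Cs * x ^ ((α + b) / 2 * s) + 1 + L with hE
  have hE0 : 0 ≤ E := by positivity
  have h1 : (Γ * (√E / x + η)) ^ 2 ≤ 2 * Γ ^ 2 * (E / x ^ 2 + η ^ 2) := by
    have : (√E / x) ^ 2 = E / x ^ 2 := by rw [div_pow, Real.sq_sqrt hE0]
    rw [← this]
    nlinarith [mul_nonneg (sq_nonneg Γ) (sq_nonneg (√E / x - η))]
  -- The radius is chosen to make this an equality. The entropy term then needs only (α + b)(2 + s)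
  -- ≤ 4.
  have h2 : η ^ 2 * x ^ α ≤ x ^ (-b) := by
    rw [← Real.rpow_mul_natCast hx0.le]
    refine rpow_mul_rpow_le hx ?_
    push_cast; linarith
  have hx2α : x ^ α / x ^ 2 = x ^ (α - 2) := by
    rw [Real.rpow_sub hx0]; norm_num
  have h3 : x ^ ((α + b) / 2 * s) * (x ^ α / x ^ 2) ≤ x ^ (-b) := by
    rw [hx2α]
    refine rpow_mul_rpow_le hx ?_
    linarith
  have h4 : x ^ α / x ^ 2 ≤ x ^ (-b) := by
    rw [hx2α]
    exact Real.rpow_le_rpow_of_exponent_le hx (by linarith)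
  have hq : 0 < x ^ (-b) := Real.rpow_pos_of_pos hx0 _
  have hLq : x ^ (-b) ≤ L * x ^ (-b) := le_mul_of_one_le_left hq.le hL
  have h5 : (E / x ^ 2 + η ^ 2) * x ^ α ≤ (Cs + 3) * (L * x ^ (-b)) := by
    have h6 : (E / x ^ 2 + η ^ 2) * x ^ α
        = Cs * (x ^ ((α + b) / 2 * s) * (x ^ α / x ^ 2)) + (1 + L) * (x ^ α / x ^ 2)
          + η ^ 2 * x ^ α := by rw [hE]; ring
    have h7 := mul_le_mul_of_nonneg_left h3 hCs.le
    have h8 := mul_le_mul_of_nonneg_left h4 (by linarith : 0 ≤ 1 + L)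
    have h9 := mul_le_mul_of_nonneg_left hLq hCs.le
    rw [h6]
    linarith
  calc _ ≤ 2 * Γ ^ 2 * (E / x ^ 2 + η ^ 2) * x ^ α := by gcongr
    _ = 2 * Γ ^ 2 * ((E / x ^ 2 + η ^ 2) * x ^ α) := by ring
    _ ≤ 2 * Γ ^ 2 * ((Cs + 3) * (L * x ^ (-b))) := by gcongr
    _ = _ := by ring

/-- The entropy cost of covering a ball of radius R₀ x^(α/2), the a priori size of the solution, at
scale x^(-b). -/
theorem entropy_rate_le {R₀ : ℝ} (hx : 1 ≤ x) (hR₀ : 0 < R₀) (h : s * (α / 2 + b) - 1 ≤ -b) :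
    (R₀ * x ^ (α / 2) / x ^ (-b)) ^ s / x ≤ R₀ ^ s * x ^ (-b) := by
  have hx0 : 0 < x := by linarith
  have h1 : R₀ * x ^ (α / 2) / x ^ (-b) = R₀ * x ^ (α / 2 + b) := by
    rw [div_eq_mul_inv, ← Real.rpow_neg hx0.le, neg_neg, mul_assoc, ← Real.rpow_add hx0]
  rw [h1, Real.mul_rpow hR₀.le (Real.rpow_pos_of_pos hx0 _).le, ← Real.rpow_mul hx0.le,
    mul_div_assoc, div_eq_mul_inv, ← Real.rpow_neg_one]
  gcongr
  exact rpow_mul_rpow_le hx (by linarith)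

end Exponents

/-! ### The learning rate -/

section Rate

/-- The squared `L²` distance of the projected hypothesis to the target. -/
theorem eLpNorm_proj_sub_target_sq {X : Type u} [MeasurableSpace X]
    {ρX : Measure X} [IsProbabilityMeasure ρX] {κ : Kernel (X × X) ℝ} {B : ℝ} (hB : 0 ≤ B)
    (htarget : ∀ᵐ p ∂(ρX.prod ρX), |target κ p| ≤ B) {f : X × X → ℝ} (hf : Measurable f) :
    eLpNorm (fun p => proj B (f p) - target κ p) 2 (ρX.prod ρX) ^ 2
      = ENNReal.ofReal (∫ p, projLoss κ B f p ∂(ρX.prod ρX)) := by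
  have h1 := eLpNorm_nnreal_pow_eq_lintegral (f := fun p => proj B (f p) - target κ p)
    (μ := ρX.prod ρX) (p := 2) two_ne_zero
  norm_num at h1
  rw [h1, ofReal_integral_eq_lintegral_ofReal (integrable_projLoss hB hf)
    (ae_of_all _ fun p => projLoss_nonneg f p)]
  refine lintegral_congr_ae ?_
  filter_upwards [htarget] with p hp
  rw [projLoss, proj_of_abs_le hp, ← ofReal_norm, ← ENNReal.ofReal_pow (norm_nonneg _),
    Real.norm_eq_abs, sq_abs]
  congr 1
  ring

variable {X : Type u} [MetricSpace X] [CompactSpace X] [MeasurableSpace X] [BorelSpace X]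
  {H : Type v} [NormedAddCommGroup H] [InnerProductSpace ℝ H] [RKHS ℝ H (X × X) ℝ]
  {ρX : Measure X} [IsProbabilityMeasure ρX] {κ : Kernel (X × X) ℝ} [IsMarkovKernel κ]
  {s Cs c M K C₀ r : ℝ}

/-- A near minimizer of the regularization error. -/
theorem MomentHypothesis.exists_comparator (hmoment : MomentHypothesis κ c M)
    (hM : 1 ≤ M) (hc : 0 < c) (hcont : ∀ k : H, Continuous fun p => k p)
    (hKb : ∀ (k : H) p, |k p| ≤ K * ‖k‖)
    (hD : ∀ lam : ℝ, 0 < lam → regError H ρX κ lam ≤ C₀ * lam ^ r) (hr1 : r ≤ 1)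
    {lam : ℝ} (hlam : 0 < lam) (hlam1 : lam ≤ 1) :
    ∃ l : H, ∫ p, (target κ p - l p) ^ 2 ∂(ρX.prod ρX) ≤ (|C₀| + 1) * lam ^ r ∧
      lam * ‖l‖ ^ 2 ≤ (|C₀| + 1) * lam ^ r ∧
      ∀ p, (target κ p - l p) ^ 2
        ≤ (2 * (c * M) ^ 2 + 2 * K ^ 2 * (|C₀| + 1)) * lam ^ (r - 1) := by
  have hpos : 0 < lam ^ r := Real.rpow_pos_of_pos hlam r
  -- Enlarging C₀ to |C₀| + 1 makes the inequality strict, so a comparator exists even if the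
  -- infimum is not attained.
  have hlt : regError H ρX κ lam < (|C₀| + 1) * lam ^ r := by
    refine (hD lam hlam).trans_lt ?_
    nlinarith [le_abs_self C₀]
  obtain ⟨l, hl⟩ := exists_lt_of_ciInf_lt hlt
  rw [hmoment.risk_sub_risk_target hM hc (hcont l).measurable (hKb l)] at hl
  have hV0 : 0 ≤ ∫ p, (target κ p - l p) ^ 2 ∂(ρX.prod ρX) :=
    integral_nonneg fun p => sq_nonneg _
  have hl0 : 0 ≤ lam * ‖l‖ ^ 2 := by positivity
  have hl1 : lam * ‖l‖ ^ 2 ≤ (|C₀| + 1) * lam ^ r := by linarith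
  refine ⟨l, by linarith, hl1, fun p => ?_⟩
  have hlr1 : 1 ≤ lam ^ (r - 1) :=
    Real.one_le_rpow_of_pos_of_le_one_of_nonpos hlam hlam1 (by linarith)
  have hlnorm : ‖l‖ ^ 2 ≤ (|C₀| + 1) * lam ^ (r - 1) := by
    rw [Real.rpow_sub_one hlam.ne', ← mul_div_assoc, le_div_iff₀ hlam]
    linarith
  have h1 : (target κ p) ^ 2 ≤ (c * M) ^ 2 := by
    rw [← sq_abs]
    exact pow_le_pow_left₀ (abs_nonneg _) (hmoment.abs_target_le hM hc p) 2
  have h2 : (l p) ^ 2 ≤ K ^ 2 * ((|C₀| + 1) * lam ^ (r - 1)) := by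
    rw [← sq_abs]
    calc |l p| ^ 2 ≤ (K * ‖l‖) ^ 2 := pow_le_pow_left₀ (abs_nonneg _) (hKb l p) 2
      _ = K ^ 2 * ‖l‖ ^ 2 := by ring
      _ ≤ _ := by gcongr
  have h3 : (c * M) ^ 2 * 1 ≤ (c * M) ^ 2 * lam ^ (r - 1) := by gcongr
  linarith [sq_nonneg (target κ p + l p)]

set_option maxHeartbeats 1000000 in
/-- The rate for the regularized least squares solution, without loss in the exponent. -/
theorem MomentHypothesis.exists_rate (hmoment : MomentHypothesis κ c M)
    (hM : 1 ≤ M) (hc : 0 < c) (hcap : CapacityCondition (X := X) H s Cs) (hs : 0 < s)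
    (hCs : 0 < Cs) (hcont : ∀ k : H, Continuous fun p => k p) (hK : 1 ≤ K)
    (hKb : ∀ (k : H) p, |k p| ≤ K * ‖k‖) {B : ℝ} (hB : 1 ≤ B)
    (hD : ∀ lam : ℝ, 0 < lam → regError H ρX κ lam ≤ C₀ * lam ^ r) (hr1 : r ≤ 1)
    {α : ℝ} (hα0 : 0 < α) (hα1 : α ≤ 1) (hα : α < (1 + s) / (s * (2 + s))) :
    ∃ C : ℝ, 0 < C ∧ ∀ m : ℕ, 1 ≤ m → ∀ L : ℝ, 1 ≤ L →
      sampleLaw ρX κ m {z | ¬ ∀ k : H, IsRegLSSolution ((m : ℝ) ^ (-α)) z k →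
        ∫ p, projLoss κ B k p ∂(ρX.prod ρX) ≤ C * L * (m : ℝ) ^ (-powerIndex α r s)}
      ≤ 4 * ENNReal.ofReal (Real.exp (-L)) := by
  set b := 1 / (2 + s) - α * s / (1 + s) with hb
  set Θ := powerIndex α r s with hΘ
  have hΘ1 : Θ ≤ α * r := min_le_left _ _
  have hΘb : Θ ≤ b := min_le_right _ _
  obtain ⟨hb0, hb_half, hcapexp, hαb⟩ := rate_exponents hs hα0 hα1 hα hb
  obtain ⟨Γ, hΓ0, hΓ⟩ := hmoment.exists_measure_sum_noise_le (ρX := ρX) hM hc hcap hcont hK hKb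
    (by linarith : 1 ≤ Cs + 2) hCs
  set C₁ := |C₀| + 1 with hC₁
  have hC₁0 : 0 < C₁ := by positivity
  set B₁ := 2 * (c * M) ^ 2 + 2 * K ^ 2 * C₁ with hB₁
  have hB₁0 : 0 < B₁ := by positivity
  set CT := 4 * B₁ + 4 * C₁ + 6 * Γ ^ 2 * (Cs + 3) with hCT
  have hCT0 : 0 < CT := by positivity
  set R₀ := √(2 * CT) with hR₀
  have hR₀0 : 0 < R₀ := Real.sqrt_pos.2 (by positivity)
  set C := 4 * B ^ 2 + (4 * CT + 24 * B ^ 2 * (Cs * R₀ ^ s + 1) + 12 * B) with hC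
  have hC0 : 0 < C := by positivity
  refine ⟨C, hC0, fun m hm L hL => ?_⟩
  have hx : (1 : ℝ) ≤ m := by exact_mod_cast hm
  have hx0 : (0 : ℝ) < m := by linarith
  set q := (m : ℝ) ^ (-Θ) with hq
  have hq0 : 0 < q := Real.rpow_pos_of_pos hx0 _
  -- If L q ≥ 1, the trivial bound 4B² suffices. Otherwise m ≥ 2 and L ≤ m, and the norm of the
  -- solution can be bounded a priori.
  by_cases hLq : 1 ≤ L * q
  · refine le_trans (le_of_eq ?_) zero_le
    convert measure_empty (μ := sampleLaw ρX κ m)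
    rw [Set.eq_empty_iff_forall_notMem]
    intro z hz
    refine hz fun k _ => ?_
    have h1 : ∫ p, projLoss κ B k p ∂(ρX.prod ρX) ≤ 4 * B ^ 2 := by
      have := integral_mono (integrable_projLoss (κ := κ) (ρX := ρX) (by linarith : 0 ≤ B)
        (hcont k).measurable) (integrable_const (4 * B ^ 2))
        (fun p => projLoss_le (by linarith) k p)
      simpa using this
    have h2 : C * 1 ≤ C * (L * q) := by gcongr
    have h3 : 4 * B ^ 2 ≤ C := by rw [hC]; exact le_add_of_nonneg_right (by positivity)
    linarith only [h1, h2, h3]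
  push Not at hLq
  have hm2 : 2 ≤ m := by
    by_contra! h
    have : m = 1 := by omega
    rw [hq, this, Nat.cast_one, Real.one_rpow, mul_one] at hLq
    linarith
  have hmb : (m : ℝ) ^ (-b) ≤ q := Real.rpow_le_rpow_of_exponent_le hx (by linarith)
  have hmb0 : 0 < (m : ℝ) ^ (-b) := Real.rpow_pos_of_pos hx0 _
  have hLq1 : q ≤ L * q := le_mul_of_one_le_left hq0.le hL
  have hinv : (m : ℝ)⁻¹ ≤ (m : ℝ) ^ (-b) := by
    rw [← Real.rpow_neg_one]
    exact Real.rpow_le_rpow_of_exponent_le hx (by linarith)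
  have hLm : L ≤ m := by
    have h1 : (m : ℝ)⁻¹ ≤ q := hinv.trans hmb
    have h2 : L * (m : ℝ)⁻¹ ≤ 1 := (mul_le_mul_of_nonneg_left h1 (by linarith)).trans hLq.le
    rwa [← div_eq_mul_inv, div_le_one hx0] at h2
  have hLm2 : L ≤ (m : ℝ) ^ 2 := hLm.trans (le_self_pow₀ hx two_ne_zero)
  set lam := (m : ℝ) ^ (-α) with hlam
  have hlam0 : 0 < lam := Real.rpow_pos_of_pos hx0 _
  have hlam1 : lam ≤ 1 := Real.rpow_le_one_of_one_le_of_nonpos hx (by linarith)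
  have hlinv : lam⁻¹ = (m : ℝ) ^ α := by rw [hlam, Real.rpow_neg hx0.le, inv_inv]
  have hlr : lam ^ r ≤ q := by
    rw [hlam, ← Real.rpow_mul hx0.le]
    exact Real.rpow_le_rpow_of_exponent_le hx (by linarith)
  have hC₁q : C₁ * lam ^ r ≤ C₁ * q := mul_le_mul_of_nonneg_left hlr hC₁0.le
  obtain ⟨l, hVr, hlnorm, hBlb⟩ :=
    hmoment.exists_comparator (ρX := ρX) hM hc hcont hKb hD hr1 hlam0 hlam1
  set V := ∫ p, (target κ p - l p) ^ 2 ∂(ρX.prod ρX) with hV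
  have hVq : V ≤ C₁ * q := hVr.trans hC₁q
  have hlq : lam * ‖l‖ ^ 2 ≤ C₁ * q := hlnorm.trans hC₁q
  set Bl := B₁ * lam ^ (r - 1) with hBl
  have hBl0 : 0 < Bl := by positivity
  -- The power of m is α - 1 - αr, at most -αr because α ≤ 1.
  have hBlm : Bl / m ≤ B₁ * q := by
    rw [hBl, mul_div_assoc]
    gcongr
    rw [hlam, ← Real.rpow_mul hx0.le, div_eq_mul_inv, ← Real.rpow_neg_one]
    exact rpow_mul_rpow_le hx (by linarith only [hΘ1, hα1])
  have hhm : Measurable fun p => (target κ p - l p) ^ 2 := by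
    have h1 := measurable_target (κ := κ)
    have h2 : Measurable fun p => l p := (hcont l).measurable
    fun_prop
  let S₁ : Set (Fin m → X) := {x | 2 * V + 3 * Bl * L / m
    ≤ pairAverage (fun p => (target κ p - l p) ^ 2) x}
  have hS₁m : MeasurableSet S₁ := measurableSet_le measurable_const (measurable_pairAverage hhm)
  have hS₁ : sampleLaw ρX κ m {z | z.1 ∈ S₁} ≤ ENNReal.ofReal (Real.exp (-L)) := by
    rw [sampleLaw_preimage_fst hS₁m]
    exact measure_pairAverage_ge_le ρX hm2 hhm hBl0 (fun p => sq_nonneg _) hBlb (by linarith)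
  set η₁ := (m : ℝ) ^ (-((α + b) / 2)) with hη₁
  have hη₁0 : 0 < η₁ := Real.rpow_pos_of_pos hx0 _
  set E := Cs * (1 / η₁) ^ s + 1 + L with hE
  have hED : E ≤ (Cs + 2) * m ^ 2 := entropy_budget_le hx hαb (by linarith) hCs hLm2
  have hS₂ := hΓ m (by omega) η₁ L hη₁0 (by linarith) hLm2 hED
  -- A deterministic radius, read off from λ‖k‖² ≤ 2CT = R₀² with λ = m^(-α).
  set R := R₀ * (m : ℝ) ^ (α / 2) with hR
  have hR0 : 0 < R := mul_pos hR₀0 (Real.rpow_pos_of_pos hx0 _)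
  have hS₃ := measure_integral_projLoss_le (ρX := ρX) (κ := κ) hcap hcont hCs hm2
    (by linarith : 0 < B) hR0 hmb0 (by linarith : 0 ≤ L)
  -- Comparator, noise and uniform lower deviation contribute 1 + 2 + 1 failure terms exp(-L).
  refine le_trans (measure_mono ?_) ((measure_union_le _ _).trans ((add_le_add
    ((measure_union_le _ _).trans (add_le_add hS₁ hS₂)) hS₃).trans (le_of_eq (by ring))))
  intro z hz
  by_contra hnot
  simp only [Set.mem_union, Set.mem_ofPred_eq, not_or, not_not] at hnot
  obtain ⟨⟨hz₁, hz₂⟩, hz₃⟩ := hnot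
  have hz₁' : pairAverage (fun p => (target κ p - l p) ^ 2) z.1 < 2 * V + 3 * Bl * L / m :=
    not_le.1 hz₁
  refine hz fun k hk => ?_
  set A := Γ * (√E / m + η₁) with hA
  have hbasic := hk.basic_inequality (κ := κ) (A := A) (by omega) hlam0 l (by positivity)
    fun k' => (hz₂ k').trans (le_of_eq (by rw [hA, ← hE]; field_simp))
  have hA2 : A ^ 2 / lam ≤ 2 * Γ ^ 2 * (Cs + 3) * (L * q) := by
    rw [div_eq_mul_inv, hlinv]
    refine (noise_level_sq_le Γ hx hα1 hb_half hαb hCs hL).trans ?_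
    gcongr
  have hQl := sum_le_pairAverage_add hm2 (fun p => sq_nonneg _) hBlb z.1
  have hT : 1 / (m : ℝ) ^ 2 * ∑ ij : Fin m × Fin m,
      (target κ (z.1 ij.1, z.1 ij.2) - k (z.1 ij.1, z.1 ij.2)) ^ 2 + lam * ‖k‖ ^ 2 / 2
      ≤ CT * (L * q) := by
    have h1 : 3 * Bl * L / m ≤ 3 * (B₁ * (L * q)) := by
      have : 3 * Bl * L / m = 3 * (L * (Bl / m)) := by ring
      rw [this]
      have := mul_le_mul_of_nonneg_left hBlm (by linarith : 0 ≤ L)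
      linarith
    have h2 := mul_le_mul_of_nonneg_left hLq1 hB₁0.le
    have h3 := mul_le_mul_of_nonneg_left hLq1 hC₁0.le
    rw [hCT]
    linarith only [h1, h2, h3, hbasic, hA2, hQl, hz₁', hBlm, hVq, hlq, hLq1]
  have hQk0 : 0 ≤ 1 / (m : ℝ) ^ 2 * ∑ ij : Fin m × Fin m,
      (target κ (z.1 ij.1, z.1 ij.2) - k (z.1 ij.1, z.1 ij.2)) ^ 2 :=
    mul_nonneg (by positivity) (Finset.sum_nonneg fun _ _ => sq_nonneg _)
  have hkR : ‖k‖ ≤ R := by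
    have h0 : CT * (L * q) ≤ CT := mul_le_of_le_one_right hCT0.le hLq.le
    have h1 : lam * ‖k‖ ^ 2 ≤ 2 * CT := by linarith only [h0, hT, hQk0]
    have h2 : ‖k‖ ^ 2 ≤ R ^ 2 := by
      rw [hR, mul_pow, hR₀, Real.sq_sqrt (by positivity), ← Real.rpow_mul_natCast hx0.le]
      push_cast
      rw [div_mul_cancel₀ _ two_ne_zero, ← hlinv, ← div_eq_mul_inv, le_div_iff₀ hlam0]
      linarith
    exact (pow_le_pow_iff_left₀ (norm_nonneg _) hR0.le two_ne_zero).1 h2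
  have hmain := hz₃ k hkR
  have hQkT : 1 / (m : ℝ) ^ 2 * ∑ ij : Fin m × Fin m,
      (target κ (z.1 ij.1, z.1 ij.2) - k (z.1 ij.1, z.1 ij.2)) ^ 2 ≤ CT * (L * q) :=
    (le_add_of_nonneg_right (by positivity)).trans hT
  have hpair : pairAverage (projLoss κ B k) z.1 ≤ 2 * (CT * (L * q)) := by
    refine (pairAverage_le_two_mul_sum hm2 (fun p => projLoss_nonneg k p) z.1).trans ?_
    refine mul_le_mul_of_nonneg_left (le_trans ?_ hQkT) zero_le_two
    refine mul_le_mul_of_nonneg_left (Finset.sum_le_sum fun ij _ => ?_) (by positivity)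
    exact projLoss_le_sq (by linarith) k _
  have hcapterm : (R / (m : ℝ) ^ (-b)) ^ s / m ≤ R₀ ^ s * q := by
    refine (entropy_rate_le hx hR₀0 hcapexp).trans ?_
    gcongr
  have hLmq : L / m ≤ L * q := by
    rw [div_eq_mul_inv]
    exact mul_le_mul_of_nonneg_left (hinv.trans hmb) (by linarith)
  have h1 : 24 * B ^ 2 * (Cs * (R / (m : ℝ) ^ (-b)) ^ s + L) / m
      ≤ 24 * B ^ 2 * (Cs * R₀ ^ s + 1) * (L * q) := by
    have h2 : 24 * B ^ 2 * (Cs * (R / (m : ℝ) ^ (-b)) ^ s + L) / m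
        = 24 * B ^ 2 * (Cs * ((R / (m : ℝ) ^ (-b)) ^ s / m) + L / m) := by ring
    have h3 : Cs * ((R / (m : ℝ) ^ (-b)) ^ s / m) ≤ Cs * (R₀ ^ s * (L * q)) := by
      refine mul_le_mul_of_nonneg_left (hcapterm.trans ?_) hCs.le
      gcongr
    rw [h2, mul_assoc (24 * B ^ 2)]
    refine mul_le_mul_of_nonneg_left ?_ (by positivity)
    linarith
  have h2 : 12 * B * (m : ℝ) ^ (-b) ≤ 12 * B * (L * q) := by
    gcongr
    exact hmb.trans hLq1
  have h3 : 0 ≤ 4 * B ^ 2 * (L * q) := by positivity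
  rw [mul_assoc, hC]
  linarith only [h1, h2, h3, hpair, hmain]

end Rate

end HyperRKHS

open HyperRKHS

theorem theorem2 {X : Type*} [MetricSpace X] [CompactSpace X] [MeasurableSpace X] [BorelSpace X]
    {H : Type*} [NormedAddCommGroup H] [InnerProductSpace ℝ H] [CompleteSpace H]
    [RKHS ℝ H (X × X) ℝ] (hH : IsHyperRKHS X H)
    (hcont : Continuous fun pq : (X × X) × (X × X) => hyperKernel H pq.1 pq.2)
    (ρX : Measure X) [IsProbabilityMeasure ρX] (κ : Kernel (X × X) ℝ) [IsMarkovKernel κ]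
    (Mstar : ℝ) (hMstar : 1 ≤ Mstar)
    (htarget : ∀ᵐ p ∂(ρX.prod ρX), |target κ p| ≤ Mstar)
    (r C₀ : ℝ) (hr0 : 0 < r) (hr1 : r ≤ 1)
    (hD : ∀ lam : ℝ, 0 < lam → regError H ρX κ lam ≤ C₀ * lam ^ r)
    (M c : ℝ) (hM : 1 ≤ M) (hc : 0 < c) (hmoment : MomentHypothesis κ c M)
    (s Cs : ℝ) (hs : 0 < s) (hCs : 0 < Cs) (hcap : CapacityCondition (X := X) H s Cs)
    (α : ℝ) (hα0 : 0 < α) (hα1 : α ≤ 1) (hα : α < (1 + s) / (s * (2 + s))) :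
    (∀ m : ℕ, 1 ≤ m → ∀ z : (Fin m → X) × (Fin m × Fin m → ℝ),
      ∃! k : H, IsRegLSSolution ((m : ℝ) ^ (-α)) z k) ∧
    ∀ ε : ℝ, 0 < ε → ε < powerIndex α r s →
      ∃ C : ℝ, 0 < C ∧ ∀ m : ℕ, 1 ≤ m → ∀ δ : ℝ, 0 < δ → δ < 1 →
        sampleLaw ρX κ m
          {z | ¬ ∀ k : H, IsRegLSSolution ((m : ℝ) ^ (-α)) z k →
            eLpNorm (fun p => proj Mstar (k p) - target κ p) 2 (ρX.prod ρX) ^ 2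
              ≤ ENNReal.ofReal (C * Real.log (4 / δ) * (m : ℝ) ^ (ε - powerIndex α r s))}
        ≤ ENNReal.ofReal δ := by
  have hcontk := continuous_apply_of_continuous_kernel hcont
  obtain ⟨K, hK, hKb⟩ := exists_abs_apply_le hcont
  refine ⟨fun m hm z => existsUnique_isRegLSSolution
    (Real.rpow_pos_of_pos (by exact_mod_cast hm) _) z, fun ε hε _ => ?_⟩
  obtain ⟨C, hC0, hC⟩ := hmoment.exists_rate hM hc hcap hs hCs hcontk hK hKb hMstar
    hD hr1 hα0 hα1 hα
  refine ⟨C, hC0, fun m hm δ hδ0 hδ1 => ?_⟩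
  have hx : (1 : ℝ) ≤ m := by exact_mod_cast hm
  have hL : 1 ≤ Real.log (4 / δ) := by
    rw [Real.le_log_iff_exp_le (by positivity), le_div_iff₀ hδ0]
    have := Real.exp_one_lt_d9
    nlinarith
  have hδ : 4 * ENNReal.ofReal (Real.exp (-Real.log (4 / δ))) = ENNReal.ofReal δ := by
    rw [Real.exp_neg, Real.exp_log (by positivity), show (4 : ℝ≥0∞) = ENNReal.ofReal 4 by simp,
      ← ENNReal.ofReal_mul (by norm_num)]
    congr 1
    field_simp
  rw [← hδ]
  refine le_trans (measure_mono ?_) (hC m hm _ hL)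
  intro z hz hgood
  refine hz fun k hk => ?_
  rw [eLpNorm_proj_sub_target_sq (by linarith) htarget (hcontk k).measurable]
  refine ENNReal.ofReal_le_ofReal ((hgood k hk).trans ?_)
  refine mul_le_mul_of_nonneg_left ?_ (by positivity)
  -- The rate already has exponent -Θ; adding ε > 0 only weakens it.
  exact Real.rpow_le_rpow_of_exponent_le hx (by linarith)
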